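/- \textbf{Model.} There are $N$ switches and, for each ordered pair $i\neq j$ in $\{1,\dots,N\}$, a queue $Q_{ij}$; time is slotted, $t=0,1,2,\dots$. A nonempty set $\mathcal S\subseteq\{0,1\}^{N\times N}$ of feasible schedules, a reconfiguration delay $\Delta_r>0$ and an initial state $(S(-1),L(0))$ with $S(-1)\in\mathcal S$, $L(0)\in\mathbb Z_{\ge 0}^{N\times N}$, $L_{ii}(0)=0$, are given. If $S(t)\in\mathcal S$ is the schedule of slot $t$ and $A_{ij}(t)\in\mathbb Z_{\ge0}$ the number of arrivals to $Q_{ij}$ at the end of slot $t$ (with $A_{ii}(t)=0$), then the queue lengths satisfy $L_{ij}(t+1)=L_{ij}(t)-D_{ij}(t)+A_{ij}(t)$. Here $D(t)=0$ if $u\le t\le u+\Delta_r$ for some slot $u$ at which the schedule is reconfigured, i.e. $S(u)\ne S(u-1)$; in all other slots $D_{ij}(t)=S_{ij}(t)$ if $L_{ij}(t)>0$ and $D_{ij}(t)=0$ if $L_{ij}(t)=0$. The variables $A_{ij}(t)$ are independent over $i\ne j$ and i.i.d. over $t$; the rate matrix is $\lambda=(\mathbb E A_{ij}(0))_{ij}$.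 A \emph{scheduling policy} chooses $S(t)\in\mathcal S$ measurably with respect to $A(0),\dots,A(t),S(0),\dots,S(t-1)$. It \emph{strongly stabilizes} the network if $\limsup_{t\to\infty}\frac1t\sum_{\tau=0}^{t-1}\mathbb E\sum_{i,j}L_{ij}(\tau)<\infty$. The traffic is \emph{admissible} if some scheduling policy strongly stabilizes the network; the \emph{capacity region} $\Lambda$ is the set of rate matrices of admissible traffic, and the \emph{load} of $\lambda$ is $\rho(\lambda)=\inf\{r:\lambda\in r\bar\Lambda,\ 0<r<1\}$ (with $\inf\emptyset=+\infty$). A policy is \emph{throughput optimal} if it strongly stabilizes the network under all traffic with load $\rho(\lambda)<1$ whose arrivals are bounded, i.e. $A_{ij}(t)\le A_{\max}$ for all $i,j,t$ and some constant $A_{\max}<\infty$ (which may depend on the traffic). \textbf{Policies.} Let $\alpha>0$ and $f(x)=x^\alpha$. The $f$-weight of $S\in\mathcal S$ at $L$ is $W_f(S,L)=\sum_{i,j}f(L_{ij})S_{ij}$. A \emph{MaxWeight-$\alpha$ policy} $\pi$ is a map that assigns to each state $(S(t-1),L(t))$ a schedule $\Pi(t)\in\mathcal S$ maximizing $W_f(\cdot,L(t))$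 over $\mathcal S$, ties being broken in any way. Let $g$ be a hysteresis function, i.e. nonnegative, continuous and strictly increasing on $[0,\infty)$ with $\lim_{x\to\infty}g(x)/x=0$ and $\lim_{x\to\infty}g(x)=\infty$. The \emph{$(g,f)$-adaptive variant} of $\pi$ uses in slot $t$ the schedule $$S(t)=\begin{cases}S(t-1)&\text{if } W_f(\Pi(t),L(t))-W_f(S(t-1),L(t))\le g\big(W_f(\Pi(t),L(t))\big),\\ \Pi(t)&\text{otherwise.}\end{cases}$$ \textbf{Proposition.} Suppose that $\lim_{x\to\infty}\dfrac{x^{\alpha-1}}{g(x^\alpha)}=0$. Then the $(g,f)$-adaptive variant of every MaxWeight-$\alpha$ policy is throughput optimal. -/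

import Mathlib

open Filter Topology MeasureTheory ProbabilityTheory
open scoped Pointwise

/-- Matrices of packet counts: queue lengths, or the arrivals during one slot. -/
abbrev PacketMatrix (N : ℕ) : Type := Fin N → Fin N → ℕ

/-- A schedule, a `0`-`1` matrix: `S i j = true` means that there is a circuit from `i` to `j`. -/
abbrev Schedule (N : ℕ) : Type := Fin N → Fin N → Bool

/-- The data of the network: the set of feasible schedules (an arbitrary set of `0`-`1` matrices),
the reconfiguration delay, and the initial state `X_0 = (S(-1), L(0))`.
There are no queues `Q_ii`: their lengths are zero. -/
structure Network (N : ℕ) where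
  feasible : Set (Schedule N)
  delay : ℝ
  delay_pos : 0 < delay
  initSchedule : Schedule N
  initSchedule_mem : initSchedule ∈ feasible
  initQueue : PacketMatrix N
  initQueue_diag : ∀ i, initQueue i i = 0

namespace Network

variable {N : ℕ}

/-- The schedule `S(t-1)` in force before slot `t`. -/
def prevSchedule (net : Network N) (s : ℕ → Schedule N) : ℕ → Schedule N
  | 0 => net.initSchedule
  | t + 1 => s t

/-- Slot `t` is lost to reconfiguration: the schedule was changed at some slot `u` with
`u ≤ t ≤ u + Δ_r`. -/
def InReconfiguration (net : Network N) (s : ℕ → Schedule N) (t : ℕ) : Prop :=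
  ∃ u : ℕ, u ≤ t ∧ (t : ℝ) ≤ u + net.delay ∧ s u ≠ net.prevSchedule s u

open Classical in
/-- The departures `D(t)` when the schedule sequence is `s` and the queue lengths are `L`. -/
noncomputable def departure (net : Network N) (s : ℕ → Schedule N) (t : ℕ) (L : PacketMatrix N) :
    PacketMatrix N :=
  fun i j => if ¬ net.InReconfiguration s t ∧ s t i j = true ∧ 0 < L i j then 1 else 0

/-- The queue lengths `L(t)` at the beginning of slot `t`, for the schedule sequence `s` and the
arrival sequence `a`: `L(t+1) = L(t) - D(t) + A(t)` (the subtraction never truncates). -/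
noncomputable def queue (net : Network N) (s : ℕ → Schedule N) (a : ℕ → PacketMatrix N) :
    ℕ → PacketMatrix N
  | 0 => net.initQueue
  | t + 1 => fun i j =>
      queue net s a t i j - net.departure s t (queue net s a t) i j + a t i j

end Network

/-- The total queue length `‖L‖ = ∑_{i,j} L_ij`. -/
def totalLength {N : ℕ} (L : PacketMatrix N) : ℕ := ∑ i, ∑ j, L i j

/-- The arrival traffic: `A_ij(t)` are independent over `(i, j)` and i.i.d. over the slots `t`,
with no arrivals on the diagonal. -/
structure IsTraffic {N : ℕ} {Ω : Type*} [MeasurableSpace Ω] (P : Measure Ω)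
    (A : ℕ → Ω → PacketMatrix N) : Prop where
  measurable : ∀ t, Measurable (A t)
  diag : ∀ t ω i, A t ω i i = 0
  indep : iIndepFun (fun (k : ℕ × Fin N × Fin N) (ω : Ω) => A k.1 ω k.2.1 k.2.2) P
  identDistrib : ∀ t i j, IdentDistrib (fun ω => A t ω i j) (fun ω => A 0 ω i j) P P

/-- The arrivals per slot and queue are bounded by a constant `A_max`. -/
def BoundedTraffic {N : ℕ} {Ω : Type*} [MeasurableSpace Ω] (P : Measure Ω)
    (A : ℕ → Ω → PacketMatrix N) : Prop :=
  ∃ Amax : ℕ, ∀ t i j, ∀ᵐ ω ∂P, A t ω i j ≤ Amax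

/-- The traffic rate matrix `λ_ij = E A_ij(0)`. -/
noncomputable def trafficRate {N : ℕ} {Ω : Type*} [MeasurableSpace Ω] (P : Measure Ω)
    (A : ℕ → Ω → PacketMatrix N) : Fin N → Fin N → ℝ :=
  fun i j => ∫ ω, (A 0 ω i j : ℝ) ∂P

namespace Network

variable {N : ℕ}

/-- A scheduling policy, as the process `S` of its schedules: `S(t)` is feasible and measurable with
respect to `A(0), …, A(t), S(0), …, S(t-1)`. -/
structure IsSchedulingPolicy (net : Network N) {Ω : Type*} [MeasurableSpace Ω]
    (A : ℕ → Ω → PacketMatrix N) (S : ℕ → Ω → Schedule N) : Prop where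
  mem : ∀ t ω, S t ω ∈ net.feasible
  adapted : ∀ t, Measurable[(⨆ τ ∈ Set.Iic t, MeasurableSpace.comap (A τ) inferInstance) ⊔
    (⨆ τ ∈ Set.Iio t, MeasurableSpace.comap (S τ) inferInstance)] (S t)

/-- Strong stability: `limsup_{t → ∞} (1/t) ∑_{τ<t} E ‖L(τ)‖ < ∞`. -/
def StronglyStable (net : Network N) {Ω : Type*} [MeasurableSpace Ω] (P : Measure Ω)
    (A : ℕ → Ω → PacketMatrix N) (S : ℕ → Ω → Schedule N) : Prop :=
  limsup (fun t : ℕ => (∑ τ ∈ Finset.range t,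
    ∫⁻ ω, (totalLength (net.queue (fun u => S u ω) (fun u => A u ω) τ) : ENNReal) ∂P) / (t : ENNReal))
    atTop < ⊤

/-- The arrival traffic is admissible: some scheduling policy strongly stabilizes the network. -/
def Admissible (net : Network N) {Ω : Type*} [MeasurableSpace Ω] (P : Measure Ω)
    (A : ℕ → Ω → PacketMatrix N) : Prop :=
  ∃ S : ℕ → Ω → Schedule N, net.IsSchedulingPolicy A S ∧ net.StronglyStable P A S

/-- The capacity region `Λ`: the rate matrices of admissible traffic. -/
def capacityRegion (net : Network N) : Set (Fin N → Fin N → ℝ) :=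
  {lam | ∃ (Ω : Type) (_ : MeasurableSpace Ω) (P : Measure Ω) (_ : IsProbabilityMeasure P)
    (A : ℕ → Ω → PacketMatrix N),
    IsTraffic P A ∧ net.Admissible P A ∧ trafficRate P A = lam}

/-- The load `ρ(λ) = inf {r : λ ∈ r Λ̄, 0 < r < 1}`, where the infimum of the empty set is `⊤`. -/
noncomputable def load (net : Network N) (lam : Fin N → Fin N → ℝ) : EReal :=
  sInf {x | ∃ r : ℝ, x = (r : EReal) ∧ lam ∈ r • closure net.capacityRegion ∧ 0 < r ∧ r < 1}

/-- A Markov scheduling policy, a map `(S(t-1), L(t)) ↦ S(t)` with feasible values. -/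
structure MarkovPolicy (net : Network N) where
  toFun : Schedule N → PacketMatrix N → Schedule N
  mem : ∀ s ∈ net.feasible, ∀ L, toFun s L ∈ net.feasible

/-- Auxiliary to `run`: a schedule sequence whose first `t` entries are those chosen by `π`. -/
noncomputable def runUpTo (net : Network N) (π : net.MarkovPolicy) (a : ℕ → PacketMatrix N) :
    ℕ → ℕ → Schedule N
  | 0 => fun _ => net.initSchedule
  | t + 1 => Function.update (runUpTo net π a t) t
      (π.toFun (net.prevSchedule (runUpTo net π a t) t) (net.queue (runUpTo net π a t) a t))

/-- The schedules `S(t) = π(S(t-1), L(t))` of the network under the Markov policy `π`, when the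
arrival sequence is `a`; see `run_eq`. -/
noncomputable def run (net : Network N) (π : net.MarkovPolicy) (a : ℕ → PacketMatrix N) (t : ℕ) :
    Schedule N :=
  net.runUpTo π a (t + 1) t

theorem prevSchedule_congr (net : Network N) {s s' : ℕ → Schedule N} {t : ℕ}
    (h : ∀ u < t, s u = s' u) : net.prevSchedule s t = net.prevSchedule s' t := by
  cases t with
  | zero => rfl
  | succ t => exact h t (Nat.lt_succ_self t)

theorem inReconfiguration_congr (net : Network N) {s s' : ℕ → Schedule N} {t : ℕ}
    (h : ∀ u ≤ t, s u = s' u) : net.InReconfiguration s t ↔ net.InReconfiguration s' t := by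
  unfold InReconfiguration
  refine exists_congr fun u => and_congr_right fun hu => and_congr_right fun _ => ?_
  rw [h u hu, net.prevSchedule_congr (s := s) (s' := s') fun v hv => h v (hv.le.trans hu)]

theorem queue_congr (net : Network N) {s s' : ℕ → Schedule N} (a : ℕ → PacketMatrix N) {t : ℕ}
    (h : ∀ u < t, s u = s' u) : net.queue s a t = net.queue s' a t := by
  induction t with
  | zero => rfl
  | succ t ih =>
    have h1 := ih fun u hu => h u (hu.trans (Nat.lt_succ_self t))
    have h2 := propext (net.inReconfiguration_congr (s := s) (s' := s') (t := t)
      fun u hu => h u (Nat.lt_succ_of_le hu))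
    funext i j
    simp only [queue, departure]
    rw [h1, h2, h t (Nat.lt_succ_self t)]

theorem runUpTo_eq_run (net : Network N) (π : net.MarkovPolicy) (a : ℕ → PacketMatrix N)
    {t u : ℕ} (h : u < t) : net.runUpTo π a t u = net.run π a u := by
  induction t with
  | zero => omega
  | succ t ih =>
    rcases Nat.lt_succ_iff_lt_or_eq.mp h with h' | rfl
    · rw [← ih h', runUpTo, Function.update_of_ne h'.ne]
    · rfl

theorem run_eq (net : Network N) (π : net.MarkovPolicy) (a : ℕ → PacketMatrix N) (t : ℕ) :
    net.run π a t =
      π.toFun (net.prevSchedule (net.run π a) t) (net.queue (net.run π a) a t) := by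
  have h : ∀ u < t, net.runUpTo π a t u = net.run π a u := fun u hu => net.runUpTo_eq_run π a hu
  rw [← net.prevSchedule_congr h, ← net.queue_congr a h, run, runUpTo, Function.update_self]

/-- Throughput optimality of a Markov policy: it strongly stabilizes the network under all bounded
arrival traffic of load less than `1`. -/
def ThroughputOptimal (net : Network N) (π : net.MarkovPolicy) : Prop :=
  ∀ (Ω : Type*) [MeasurableSpace Ω] (P : Measure Ω) [IsProbabilityMeasure P]
    (A : ℕ → Ω → PacketMatrix N),
    IsTraffic P A → BoundedTraffic P A → net.load (trafficRate P A) < 1 →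
      net.StronglyStable P A (fun t ω => net.run π (fun u => A u ω) t)

end Network

/-- The `f`-weight `∑_{i,j} f(L_ij) S_ij` of the schedule `S`. -/
noncomputable def fWeight {N : ℕ} (f : ℝ → ℝ) (S : Schedule N) (L : PacketMatrix N) : ℝ :=
  ∑ i, ∑ j, f (L i j) * (if S i j = true then 1 else 0)

namespace Network

variable {N : ℕ}

/-- `π` is a MaxWeight-`f` policy: it always selects a feasible schedule of maximal `f`-weight
(with ties broken in any way). -/
def IsMaxWeight (net : Network N) (f : ℝ → ℝ) (π : net.MarkovPolicy) : Prop :=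
  ∀ s ∈ net.feasible, ∀ L, ∀ S ∈ net.feasible, fWeight f S L ≤ fWeight f (π.toFun s L) L

open Classical in
/-- The `(g, f)`-adaptive variant of the Markov policy `π`. -/
noncomputable def adaptive (net : Network N) (g f : ℝ → ℝ) (π : net.MarkovPolicy) :
    net.MarkovPolicy where
  toFun s L :=
    if fWeight f (π.toFun s L) L - fWeight f s L ≤ g (fWeight f (π.toFun s L) L) then s
    else π.toFun s L
  mem s hs L := by
    split_ifs
    · exact hs
    · exact π.mem s hs L

end Network

/-- A hysteresis function: nonnegative, continuous and strictly increasing on `[0, ∞)` (the only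
arguments that occur), and sublinear. -/
structure IsHysteresis (g : ℝ → ℝ) : Prop where
  nonneg : ∀ x, 0 ≤ x → 0 ≤ g x
  continuousOn : ContinuousOn g (Set.Ici 0)
  strictMonoOn : StrictMonoOn g (Set.Ici 0)
  sublinear : Tendsto (fun x => g x / x) atTop (𝓝 0)

/-! ### Inequalities for real powers -/

/-! The proof is a Lyapunov drift argument over windows of a fixed length `T`, with the square of
the `ℓ^(1+α)` norm `Φ` of the queue lengths as Lyapunov function. Let `m` be the longest queue and
`W` the maximal weight. Stability under any policy forces every nonnegative linear functional of the
rates to be at most its maximum over the feasible schedules (`capacityRegion_weight_le`). Load below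
one therefore gives `∑ L^α λ ≤ r W` for some `r < 1`, so a policy that serves weight close to `W` in
most slots has negative drift.

Two losses must be controlled. The hysteresis costs at most `g(W)`, which is `o(W)`. For the
reconfigurations, note that lengths move by a bounded amount during a window, so weights move by a
small multiple of `g(m^α)` once `m` is large; this is what the hypothesis on `x^(α-1) / g(x^α)`,
together with `g → ∞`, provides. A schedule just switched to has maximal weight, hence its deficit
cannot exceed the threshold before the window ends (`adaptive_no_second_switch`). A window thus
loses boundedly many slots, a negligible fraction when `T` is large (`adaptive_window_drift`).

The drift of `∑ L^(1+α)` is of order `-m^α`, which for `α < 1` does not control mean queue lengths.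
Passing to `Φ²` multiplies it by about `Φ² / ∑ L^(1+α)` and makes it of order `-Φ` for every `α`
(`sq_lpSize_le`, `exists_adaptive_drift`). In expectation the arrival fluctuations vanish by
independence (`integrable_fluctuation`), and summing over time bounds the averages of `E Φ`. -/

theorem rpow_tangent_le {p x y : ℝ} (hp : 1 ≤ p) (hx : 0 ≤ x) (hy : 0 ≤ y) :
    x ^ p + p * x ^ (p - 1) * (y - x) ≤ y ^ p := by
  -- Bernoulli's inequality for `y / x` needs `x ≠ 0`. At `x = 0` the case `p = 1` is separate
  -- because `0 ^ 0 = 1`.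
  rcases hx.eq_or_lt with rfl | hx
  · rcases hp.eq_or_lt with rfl | hp
    · simp
    · rw [Real.zero_rpow (by linarith), Real.zero_rpow (by linarith)]
      simpa using Real.rpow_nonneg hy p
  · have h := one_add_mul_self_le_rpow_one_add (s := y / x - 1)
      (by linarith [div_nonneg hy hx.le]) hp
    have h2 : x ^ p = x ^ (p - 1) * x := by
      rw [← Real.rpow_add_one hx.ne']; ring_nf
    have h3 : 1 + (y / x - 1) = y / x := by ring
    rw [h3, Real.div_rpow hy hx.le, le_div_iff₀ (by positivity)] at h
    calc x ^ p + p * x ^ (p - 1) * (y - x) = (1 + p * (y / x - 1)) * x ^ p := by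
          rw [h2]; field_simp
      _ ≤ y ^ p := h

/-- If `g (m ^ α)` dominates both `m ^ (α - 1)` and the constants, then `x ↦ x ^ α` varies by
`o(g (m ^ α))` over bounded distances below `m`. -/
theorem exists_abs_rpow_sub_rpow_le {α : ℝ} (hα : 0 < α) {g : ℝ → ℝ} (hg : Tendsto g atTop atTop)
    (hgα : Tendsto (fun x : ℝ => x ^ (α - 1) / g (x ^ α)) atTop (𝓝 0))
    {C δ : ℝ} (hC : 0 < C) (hδ : 0 < δ) :
    ∃ M, ∀ m ≥ M, ∀ x y : ℝ, 0 ≤ x → 0 ≤ y → x ≤ m + C → y ≤ m + C → |x - y| ≤ C →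
      |x ^ α - y ^ α| ≤ δ * g (m ^ α) := by
  suffices H : ∃ M, ∀ m ≥ M, ∀ x y : ℝ, 0 ≤ y → y ≤ x → x ≤ m + C → x - y ≤ C →
      x ^ α - y ^ α ≤ δ * g (m ^ α) by
    obtain ⟨M, hM⟩ := H
    refine ⟨M, fun m hm x y hx hy hxm hym hxy => ?_⟩
    rcases le_total y x with h | h
    · rw [abs_of_nonneg (sub_nonneg.2 (Real.rpow_le_rpow hy h hα.le))]
      exact hM m hm x y hy h hxm ((le_abs_self _).trans hxy)
    · rw [abs_sub_comm, abs_of_nonneg (sub_nonneg.2 (Real.rpow_le_rpow hx h hα.le))]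
      rw [abs_sub_comm] at hxy
      exact hM m hm y x hx h hym ((le_abs_self _).trans hxy)
  have hgm : Tendsto (fun m : ℝ => g (m ^ α)) atTop atTop := hg.comp (tendsto_rpow_atTop hα)
  -- For `α ≤ 1` the power is subadditive, so the variation is at most the constant `C ^ α` even
  -- near zero, where the derivative is unbounded; `g → ∞` absorbs it. For `α ≥ 1` the derivative
  -- bound `α x^(α-1)` is used, with `x ≤ m + C ≤ 2m`.
  rcases le_total α 1 with h1 | h1
  · obtain ⟨M, hM⟩ := eventually_atTop.1 (hgm.eventually_ge_atTop (C ^ α / δ))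
    refine ⟨M, fun m hm x y hy hyx _ hxy => ?_⟩
    have h2 := Real.rpow_add_le_add_rpow hy (sub_nonneg.2 hyx) hα.le h1
    have h3 := Real.rpow_le_rpow (sub_nonneg.2 hyx) hxy hα.le
    have h4 := (div_le_iff₀' hδ).1 (hM m hm)
    rw [add_sub_cancel] at h2
    linarith
  · have hpos : 0 < α * 2 ^ (α - 1) * C := by positivity
    have e1 := hgα.eventually_lt_const (div_pos hδ hpos)
    obtain ⟨M, hM⟩ := eventually_atTop.1
      ((e1.and (hgm.eventually_gt_atTop 0)).and (eventually_ge_atTop C))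
    refine ⟨M, fun m hm x y hy hyx hxm hxy => ?_⟩
    obtain ⟨⟨h2, h3⟩, h4⟩ := hM m hm
    have hx := hy.trans hyx
    have ht := rpow_tangent_le h1 hx hy
    have h5 : x ^ (α - 1) ≤ 2 ^ (α - 1) * m ^ (α - 1) := by
      rw [← Real.mul_rpow (by norm_num) (hC.le.trans h4)]
      exact Real.rpow_le_rpow hx (by linarith) (by linarith)
    have hx0 := Real.rpow_nonneg hx (α - 1)
    have hm0 : 0 ≤ m := hC.le.trans h4
    rw [div_lt_div_iff₀ h3 hpos] at h2
    calc x ^ α - y ^ α ≤ α * x ^ (α - 1) * (x - y) := by linarith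
      _ ≤ α * (2 ^ (α - 1) * m ^ (α - 1)) * C := by gcongr
      _ = m ^ (α - 1) * (α * 2 ^ (α - 1) * C) := by ring
      _ ≤ δ * g (m ^ α) := h2.le

/-! ### The `ℓ^p` size of a nonnegative vector -/

/-- The `ℓ^p` norm of a vector with nonnegative entries. -/
noncomputable def lpSize {ι : Type*} [Fintype ι] (p : ℝ) (x : ι → ℝ) : ℝ :=
  (∑ k, x k ^ p) ^ (1 / p)

section lpSize

variable {ι : Type*} [Fintype ι] {p : ℝ} {x y : ι → ℝ}

theorem lpSize_nonneg (hx : 0 ≤ x) : 0 ≤ lpSize p x :=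
  Real.rpow_nonneg (Finset.sum_nonneg fun k _ => Real.rpow_nonneg (hx k) p) _

theorem le_lpSize (hp : 1 ≤ p) (hx : 0 ≤ x) (k : ι) : x k ≤ lpSize p x := by
  have h : x k ^ p ≤ ∑ k, x k ^ p :=
    Finset.single_le_sum (f := fun k => x k ^ p) (fun k _ => Real.rpow_nonneg (hx k) p)
      (Finset.mem_univ k)
  calc x k = (x k ^ p) ^ (1 / p) := by
        rw [one_div, Real.rpow_rpow_inv (hx k) (by linarith)]
    _ ≤ _ := Real.rpow_le_rpow (Real.rpow_nonneg (hx k) p) h (by positivity)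

theorem lpSize_mono (hp : 1 ≤ p) (hx : 0 ≤ x) (hxy : x ≤ y) : lpSize p x ≤ lpSize p y := by
  refine Real.rpow_le_rpow (Finset.sum_nonneg fun k _ => Real.rpow_nonneg (hx k) p) ?_
    (by positivity)
  exact Finset.sum_le_sum fun k _ => Real.rpow_le_rpow (hx k) (hxy k) (by linarith)

theorem lpSize_le_add (hp : 1 ≤ p) (hx : 0 ≤ x) (hy : 0 ≤ y) {C : ℝ} (hC : 0 ≤ C)
    (hxy : ∀ k, |y k - x k| ≤ C) :
    lpSize p y ≤ lpSize p x + lpSize p (fun _ : ι => C) := by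
  have h := Real.Lp_add_le_of_nonneg (s := Finset.univ) (f := x) (g := fun _ : ι => C) hp
    (fun k _ => hx k) (fun _ _ => hC)
  refine (lpSize_mono hp hy fun k => ?_).trans h
  have := (le_abs_self _).trans (hxy k)
  simp only
  linarith

/-- First-order expansion of the squared norm, whose gradient at `x` is `2 (X² / ∑ x^p) x^(p-1)`.
Convexity of `t ↦ t^p` bounds the increment of `∑ x^p` by its derivative at the new point `y`, which
is why `y ^ (p - 1)` appears; concavity of the `p`-th root passes from that sum to the norm. -/
theorem sq_lpSize_le (hp : 1 ≤ p) (hx : 0 ≤ x) (hy : 0 ≤ y) {C : ℝ} (hC : 0 ≤ C)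
    (hxy : ∀ k, |y k - x k| ≤ C) (hpos : 0 < ∑ k, x k ^ p) :
    lpSize p y ^ 2 ≤ lpSize p x ^ 2 + lpSize p (fun _ : ι => C) ^ 2 +
      2 * (lpSize p x ^ 2 / ∑ k, x k ^ p) * ∑ k, y k ^ (p - 1) * (y k - x k) := by
  have h1 := lpSize_le_add hp hx hy hC hxy
  have h2 := lpSize_le_add hp hy hx hC fun k => (abs_sub_comm _ _).trans_le (hxy k)
  set X := lpSize p x with hX
  set Y := lpSize p y with hY
  set V := ∑ k, x k ^ p with hV
  set U := ∑ k, y k ^ p with hU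
  have hp0 : 0 < p := by linarith
  have hX0 : 0 ≤ X := lpSize_nonneg hx
  have hU0 : 0 ≤ U := Finset.sum_nonneg fun k _ => Real.rpow_nonneg (hy k) p
  have hUV : U - V ≤ p * ∑ k, y k ^ (p - 1) * (y k - x k) := by
    rw [hU, hV, ← Finset.sum_sub_distrib, Finset.mul_sum]
    refine Finset.sum_le_sum fun k _ => ?_
    linarith [rpow_tangent_le hp (hy k) (hx k)]
  have hB : Y ≤ X * (1 + 1 / p * (U / V - 1)) := by
    have := rpow_one_add_le_one_add_mul_self (s := U / V - 1)
      (by linarith [div_nonneg hU0 hpos.le]) (p := 1 / p) (by positivity)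
      ((div_le_one hp0).2 hp)
    rw [show 1 + (U / V - 1) = U / V by ring, Real.div_rpow hU0 hpos.le,
      div_le_iff₀ (by positivity)] at this
    calc Y ≤ _ := this
      _ = _ := mul_comm _ _
  have hB2 : X * (Y - X) ≤ X ^ 2 / V * ∑ k, y k ^ (p - 1) * (y k - x k) := by
    calc X * (Y - X) ≤ X * (X * (1 / p * (U / V - 1))) := by
          gcongr; linarith
      _ = X ^ 2 / V * (1 / p) * (U - V) := by field_simp
      _ ≤ X ^ 2 / V * (1 / p) * (p * ∑ k, y k ^ (p - 1) * (y k - x k)) := by gcongr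
      _ = _ := by field_simp
  -- `Y² = X² + 2X(Y - X) + (Y - X)²`, and `|Y - X|` is at most the norm of the constant vector `C`.
  nlinarith

end lpSize

/-! ### Necessary conditions for stability -/

namespace Network

variable {N : ℕ}

theorem departure_le (net : Network N) (s : ℕ → Schedule N) (t : ℕ) (L : PacketMatrix N)
    (i j : Fin N) : net.departure s t L i j ≤ if s t i j = true then 1 else 0 := by
  unfold departure
  split_ifs <;> simp_all

theorem departure_le_queue (net : Network N) (s : ℕ → Schedule N) (t : ℕ) (L : PacketMatrix N)
    (i j : Fin N) : net.departure s t L i j ≤ L i j := by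
  unfold departure
  split_ifs with h
  · exact h.2.2
  · exact Nat.zero_le _

theorem queue_succ_add (net : Network N) (s : ℕ → Schedule N) (a : ℕ → PacketMatrix N) (t : ℕ)
    (i j : Fin N) : net.queue s a (t + 1) i j + net.departure s t (net.queue s a t) i j =
      net.queue s a t i j + a t i j := by
  have := net.departure_le_queue s t (net.queue s a t) i j
  simp only [queue]
  omega

theorem sum_arrivals_le (net : Network N) (s : ℕ → Schedule N) (a : ℕ → PacketMatrix N) (T : ℕ)
    (i j : Fin N) : ∑ t ∈ Finset.range T, a t i j ≤
      net.queue s a T i j + ∑ t ∈ Finset.range T, if s t i j = true then 1 else 0 := by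
  induction T with
  | zero => simp
  | succ T ih =>
    have h1 := net.queue_succ_add s a T i j
    have h2 := net.departure_le s T (net.queue s a T) i j
    rw [Finset.sum_range_succ, Finset.sum_range_succ]
    omega

/-- If every feasible schedule has weight at most `H` for the weights `c`, then in `T` slots at most
`T * H` of the weighted arrivals can have departed. -/
theorem weighted_arrivals_le (net : Network N) {s : ℕ → Schedule N} (hs : ∀ t, s t ∈ net.feasible)
    (a : ℕ → PacketMatrix N) {c : Fin N × Fin N → ℝ} (hc : 0 ≤ c) {H : ℝ}
    (hH : ∀ S ∈ net.feasible, ∑ k : Fin N × Fin N, c k * (if S k.1 k.2 = true then 1 else 0) ≤ H)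
    (T : ℕ) :
    ∑ k, c k * ∑ t ∈ Finset.range T, (a t k.1 k.2 : ℝ) ≤
      (∑ k, c k) * totalLength (net.queue s a T) + T * H := by
  have h1 : ∀ k : Fin N × Fin N, c k * ∑ t ∈ Finset.range T, (a t k.1 k.2 : ℝ) ≤
      c k * net.queue s a T k.1 k.2 +
        ∑ t ∈ Finset.range T, c k * (if s t k.1 k.2 = true then 1 else 0) := fun k => by
    rw [← Finset.mul_sum, ← mul_add]
    refine mul_le_mul_of_nonneg_left ?_ (hc k)
    exact_mod_cast net.sum_arrivals_le s a T k.1 k.2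
  have h2 : ∀ k : Fin N × Fin N, net.queue s a T k.1 k.2 ≤ totalLength (net.queue s a T) :=
    fun k => by
      rw [totalLength, ← Fintype.sum_prod_type' (f := fun i j => net.queue s a T i j)]
      exact Finset.single_le_sum (f := fun k : Fin N × Fin N => net.queue s a T k.1 k.2)
        (fun _ _ => Nat.zero_le _) (Finset.mem_univ k)
  calc _ ≤ ∑ k, (c k * net.queue s a T k.1 k.2 +
        ∑ t ∈ Finset.range T, c k * (if s t k.1 k.2 = true then 1 else 0)) :=
        Finset.sum_le_sum fun k _ => h1 k
    _ = ∑ k, c k * net.queue s a T k.1 k.2 + ∑ t ∈ Finset.range T,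
        ∑ k : Fin N × Fin N, c k * (if s t k.1 k.2 = true then 1 else 0) := by
        rw [Finset.sum_add_distrib, Finset.sum_comm (s := Finset.univ)]
    _ ≤ ∑ k, c k * (totalLength (net.queue s a T) : ℝ) + ∑ t ∈ Finset.range T, H := by
        gcongr with k _ t _
        · exact hc k
        · exact_mod_cast h2 k
        · exact hH _ (hs t)
    _ = _ := by simp [Finset.sum_mul]

/-- Strong stability bounds the expected total queue length along a subsequence of the slots. -/
theorem StronglyStable.exists_bound {net : Network N} {Ω : Type*} [MeasurableSpace Ω]
    {P : Measure Ω} {A : ℕ → Ω → PacketMatrix N} {S : ℕ → Ω → Schedule N}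
    (h : net.StronglyStable P A S) : ∃ C : NNReal, ∃ᶠ t in atTop,
      ∫⁻ ω, (totalLength (net.queue (fun u => S u ω) (fun u => A u ω) t) : ENNReal) ∂P ≤ C := by
  obtain ⟨C, hC1, hC2⟩ := exists_between h
  lift C to NNReal using hC2.ne
  refine ⟨2 * C, frequently_atTop.2 fun n => ?_⟩
  obtain ⟨n0, hn0⟩ := eventually_atTop.1 (eventually_lt_of_limsup_lt hC1)
  set e : ℕ → ENNReal := fun τ =>
    ∫⁻ ω, (totalLength (net.queue (fun u => S u ω) (fun u => A u ω) τ) : ENNReal) ∂P with he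
  set m := n + n0 + 1 with hm
  have h1 := hn0 (2 * m) (by omega)
  have hm0 : ((2 * m : ℕ) : ENNReal) ≠ 0 := by simp [hm]
  rw [ENNReal.div_lt_iff (Or.inl hm0) (Or.inl (ENNReal.natCast_ne_top _))] at h1
  -- The average over `2m` slots is below `C`, so the expectation cannot exceed `2C` throughout the
  -- second half.
  have h2 : ∃ τ ∈ Finset.Ico m (2 * m), e τ ≤ (2 * C : NNReal) := by
    by_contra! hlt
    refine h1.not_ge ?_
    calc (C : ENNReal) * (2 * m : ℕ) = ∑ τ ∈ Finset.Ico m (2 * m), ((2 * C : NNReal) : ENNReal) := by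
          rw [Finset.sum_const, Nat.card_Ico, show 2 * m - m = m by omega]
          push_cast
          rw [nsmul_eq_mul]
          ring
      _ ≤ ∑ τ ∈ Finset.Ico m (2 * m), e τ := Finset.sum_le_sum fun τ hτ => (hlt τ hτ).le
      _ ≤ ∑ τ ∈ Finset.range (2 * m), e τ := Finset.sum_le_sum_of_subset fun x hx =>
          Finset.mem_range.2 (Finset.mem_Ico.1 hx).2
  obtain ⟨τ, hτ1, hτ2⟩ := h2
  exact ⟨τ, by have := (Finset.mem_Ico.1 hτ1).1; omega, hτ2⟩

/-- By conservation of packets, the weighted arrivals of `T` slots exceed `T * H` by at most a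
multiple of the queue length at time `T`. Its expectation is bounded for infinitely many `T`, so
dividing by `T` gives the bound on the rates. -/
theorem capacityRegion_weight_le (net : Network N) {lam : Fin N → Fin N → ℝ}
    (hlam : lam ∈ net.capacityRegion) {c : Fin N × Fin N → ℝ} (hc : 0 ≤ c) {H : ℝ}
    (hH : ∀ S ∈ net.feasible, ∑ k : Fin N × Fin N, c k * (if S k.1 k.2 = true then 1 else 0) ≤ H) :
    ∑ k : Fin N × Fin N, c k * lam k.1 k.2 ≤ H := by
  obtain ⟨Ω, _, P, _, A, hA, ⟨S, hS, hst⟩, rfl⟩ := hlam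
  obtain ⟨C, hC⟩ := hst.exists_bound
  have hH0 : 0 ≤ H := le_trans (Finset.sum_nonneg fun k _ =>
    mul_nonneg (hc k) (by split_ifs <;> norm_num)) (hH _ net.initSchedule_mem)
  have hmeas : ∀ t (k : Fin N × Fin N), Measurable fun ω => A t ω k.1 k.2 := fun t k =>
    (measurable_pi_apply k.2).comp ((measurable_pi_apply k.1).comp (hA.measurable t))
  have hmeas' : ∀ t (k : Fin N × Fin N), Measurable fun ω => ENNReal.ofReal (A t ω k.1 k.2) :=
    fun t k => (measurable_from_nat (f := fun n : ℕ => ENNReal.ofReal n)).comp (hmeas t k)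
  set R := trafficRate P A with hR
  -- Only an inequality: traffic in the capacity region need not have finite mean, and the Bochner
  -- integral defining the rate is then `0`.
  have hrate : ∀ t (k : Fin N × Fin N),
      ENNReal.ofReal (R k.1 k.2) ≤ ∫⁻ ω, ENNReal.ofReal (A t ω k.1 k.2) ∂P := fun t k => by
    have h1 : ∫⁻ ω, ENNReal.ofReal (A t ω k.1 k.2) ∂P =
        ∫⁻ ω, ENNReal.ofReal (A 0 ω k.1 k.2) ∂P :=
      ((hA.identDistrib t k.1 k.2).comp
        (measurable_from_nat (f := fun n : ℕ => ENNReal.ofReal n))).lintegral_eq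
    rw [h1, hR, trafficRate, integral_eq_lintegral_of_nonneg_ae
      (ae_of_all _ fun ω => Nat.cast_nonneg _)
      ((measurable_from_nat (f := fun n : ℕ => (n : ℝ))).comp (hmeas 0 k)).aestronglyMeasurable]
    exact ENNReal.ofReal_toReal_le
  have key : ∀ T : ℕ,
      ∫⁻ ω, (totalLength (net.queue (fun u => S u ω) (fun u => A u ω) T) : ENNReal) ∂P ≤ C →
      T * ∑ k : Fin N × Fin N, c k * R k.1 k.2 ≤ (∑ k, c k) * C + T * H := by
    intro T hT
    have hcs : 0 ≤ ∑ k, c k := Finset.sum_nonneg fun k _ => hc k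
    have h2 : ∫⁻ ω, ENNReal.ofReal (∑ k : Fin N × Fin N, c k * ∑ t ∈ Finset.range T,
        (A t ω k.1 k.2 : ℝ)) ∂P ≤ ENNReal.ofReal ((∑ k, c k) * C + T * H) := by
      calc _ ≤ ∫⁻ ω, (ENNReal.ofReal (∑ k, c k) *
            (totalLength (net.queue (fun u => S u ω) (fun u => A u ω) T) : ENNReal) +
            ENNReal.ofReal (T * H)) ∂P := by
            refine lintegral_mono fun ω => ?_
            rw [← ENNReal.ofReal_natCast, ← ENNReal.ofReal_mul hcs,
              ← ENNReal.ofReal_add (by positivity) (by positivity)]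
            exact ENNReal.ofReal_le_ofReal (net.weighted_arrivals_le (fun t => hS.mem t ω) _ hc hH T)
        _ = ENNReal.ofReal (∑ k, c k) * ∫⁻ ω,
            (totalLength (net.queue (fun u => S u ω) (fun u => A u ω) T) : ENNReal) ∂P +
            ENNReal.ofReal (T * H) := by
            rw [lintegral_add_right _ measurable_const, lintegral_const_mul' _ _ ENNReal.ofReal_ne_top]
            simp
        _ ≤ ENNReal.ofReal (∑ k, c k) * C + ENNReal.ofReal (T * H) := by gcongr
        _ = _ := by
            rw [ENNReal.ofReal_add (by positivity) (by positivity), ENNReal.ofReal_mul hcs,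
              ENNReal.ofReal_coe_nnreal]
    have h3 : ∫⁻ ω, ENNReal.ofReal (∑ k : Fin N × Fin N, c k * ∑ t ∈ Finset.range T,
        (A t ω k.1 k.2 : ℝ)) ∂P = ∑ k : Fin N × Fin N, ENNReal.ofReal (c k) *
          ∑ t ∈ Finset.range T, ∫⁻ ω, ENNReal.ofReal (A t ω k.1 k.2) ∂P := by
      have h4 : ∀ ω, ENNReal.ofReal (∑ k : Fin N × Fin N, c k * ∑ t ∈ Finset.range T,
          (A t ω k.1 k.2 : ℝ)) = ∑ k : Fin N × Fin N, ENNReal.ofReal (c k) *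
          ∑ t ∈ Finset.range T, ENNReal.ofReal (A t ω k.1 k.2) := fun ω => by
        rw [ENNReal.ofReal_sum_of_nonneg fun k _ => mul_nonneg (hc k) (by positivity)]
        refine Finset.sum_congr rfl fun k _ => ?_
        rw [ENNReal.ofReal_mul (hc k), ENNReal.ofReal_sum_of_nonneg fun t _ => by positivity]
      simp_rw [h4]
      rw [lintegral_finsetSum _ fun k _ => (Finset.measurable_sum _ fun t _ => hmeas' t k).const_mul _]
      refine Finset.sum_congr rfl fun k _ => ?_
      rw [lintegral_const_mul _ (Finset.measurable_sum _ fun t _ => hmeas' t k),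
        lintegral_finsetSum _ fun t _ => hmeas' t k]
    have h5 : ENNReal.ofReal (T * ∑ k : Fin N × Fin N, c k * R k.1 k.2) ≤
        ENNReal.ofReal ((∑ k, c k) * C + T * H) := by
      refine le_trans ?_ (h3 ▸ h2)
      have hR0 : ∀ k : Fin N × Fin N, 0 ≤ R k.1 k.2 := fun k =>
        integral_nonneg fun ω => Nat.cast_nonneg _
      rw [Finset.mul_sum, ENNReal.ofReal_sum_of_nonneg fun k _ =>
        mul_nonneg (Nat.cast_nonneg _) (mul_nonneg (hc k) (hR0 k))]
      refine Finset.sum_le_sum fun k _ => ?_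
      rw [mul_left_comm, ENNReal.ofReal_mul (hc k), ENNReal.ofReal_mul (Nat.cast_nonneg _)]
      gcongr
      rw [ENNReal.ofReal_natCast]
      calc _ = ∑ t ∈ Finset.range T, ENNReal.ofReal (R k.1 k.2) := by simp
        _ ≤ _ := Finset.sum_le_sum fun t _ => hrate t k
    exact (ENNReal.ofReal_le_ofReal_iff (by positivity)).1 h5
  by_contra! hlt
  set G := ∑ k : Fin N × Fin N, c k * R k.1 k.2 with hG
  have hbig : ∀ᶠ T : ℕ in atTop, (∑ k, c k) * C < T * (G - H) :=
    (tendsto_natCast_atTop_atTop.atTop_mul_const (sub_pos.2 hlt)).eventually_gt_atTop _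
  obtain ⟨T, hT1, hT2⟩ := (hC.and_eventually hbig).exists
  have := key T hT1
  linarith

/-- The bound on the capacity region defines a closed half-space, so it survives the closure and
scales with `r`. It serves twice: with `c = L^α` for the drift, and with an indicator and `H = 0`
for queues that no schedule serves. -/
theorem exists_lt_one_weight_le_of_load_lt_one (net : Network N) {lam : Fin N → Fin N → ℝ}
    (hlam : net.load lam < 1) : ∃ r : ℝ, 0 < r ∧ r < 1 ∧ ∀ c : Fin N × Fin N → ℝ, 0 ≤ c → ∀ H : ℝ,
      (∀ S ∈ net.feasible, ∑ k : Fin N × Fin N, c k * (if S k.1 k.2 = true then 1 else 0) ≤ H) →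
      ∑ k : Fin N × Fin N, c k * lam k.1 k.2 ≤ r * H := by
  obtain ⟨x, ⟨r, rfl, hr, hr0, hr1⟩, -⟩ := sInf_lt_iff.1 hlam
  refine ⟨r, hr0, hr1, fun c hc H hH => ?_⟩
  obtain ⟨mu, hmu, rfl⟩ := hr
  have hcl : IsClosed {mu : Fin N → Fin N → ℝ | ∑ k : Fin N × Fin N, c k * mu k.1 k.2 ≤ H} :=
    isClosed_le (by fun_prop) continuous_const
  have h := closure_minimal (fun m hm => net.capacityRegion_weight_le hm hc hH) hcl hmu
  calc ∑ k : Fin N × Fin N, c k * (r • mu) k.1 k.2 = r * ∑ k : Fin N × Fin N, c k * mu k.1 k.2 := by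
        rw [Finset.mul_sum]
        exact Finset.sum_congr rfl fun k _ => by simp only [Pi.smul_apply, smul_eq_mul]; ring
    _ ≤ r * H := mul_le_mul_of_nonneg_left h hr0.le

end Network

/-! ### Weights of schedules -/

/-- The queue lengths as a real vector indexed by the pairs of switches. -/
def queueVec {N : ℕ} (L : PacketMatrix N) (k : Fin N × Fin N) : ℝ := L k.1 k.2

/-- The length of the longest queue. -/
def maxLength {N : ℕ} (L : PacketMatrix N) : ℕ :=
  Finset.univ.sup fun k : Fin N × Fin N => L k.1 k.2

theorem queueVec_nonneg {N : ℕ} (L : PacketMatrix N) : 0 ≤ queueVec L :=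
  fun _ => Nat.cast_nonneg _

theorem le_maxLength {N : ℕ} (L : PacketMatrix N) (k : Fin N × Fin N) : L k.1 k.2 ≤ maxLength L :=
  Finset.le_sup (f := fun k : Fin N × Fin N => L k.1 k.2) (Finset.mem_univ k)

theorem queueVec_le_maxLength {N : ℕ} (L : PacketMatrix N) (k : Fin N × Fin N) :
    queueVec L k ≤ maxLength L :=
  Nat.cast_le.2 (le_maxLength L k)

theorem exists_eq_maxLength {N : ℕ} {L : PacketMatrix N} (h : 0 < maxLength L) :
    ∃ k : Fin N × Fin N, L k.1 k.2 = maxLength L := by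
  have hne : (Finset.univ : Finset (Fin N × Fin N)).Nonempty := by
    by_contra hne
    rw [Finset.not_nonempty_iff_eq_empty] at hne
    simp [maxLength, hne] at h
  obtain ⟨k, -, hk⟩ := Finset.exists_mem_eq_sup _ hne fun k : Fin N × Fin N => L k.1 k.2
  exact ⟨k, hk.symm⟩

theorem fWeight_eq_sum {N : ℕ} (f : ℝ → ℝ) (S : Schedule N) (L : PacketMatrix N) :
    fWeight f S L = ∑ k, f (queueVec L k) * (if S k.1 k.2 = true then 1 else 0) := by
  rw [fWeight, ← Fintype.sum_prod_type']
  rfl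

theorem abs_fWeight_sub_le {N : ℕ} {f : ℝ → ℝ} {L L' : PacketMatrix N} {e : ℝ}
    (h : ∀ k, |f (queueVec L k) - f (queueVec L' k)| ≤ e) (S : Schedule N) :
    |fWeight f S L - fWeight f S L'| ≤ Fintype.card (Fin N × Fin N) * e := by
  rw [fWeight_eq_sum, fWeight_eq_sum, ← Finset.sum_sub_distrib, ← nsmul_eq_mul]
  refine (Finset.abs_sum_le_sum_abs _ _).trans (Finset.sum_le_card_nsmul _ _ _ fun k _ => ?_)
  rw [← sub_mul, abs_mul]
  refine le_trans (mul_le_of_le_one_right (abs_nonneg _) ?_) (h k)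
  split_ifs <;> simp

namespace Network

variable {N : ℕ}

/-- The weight of the schedule selected by `π`. -/
noncomputable def maxWeight (net : Network N) (f : ℝ → ℝ) (π : net.MarkovPolicy)
    (L : PacketMatrix N) : ℝ :=
  fWeight f (π.toFun net.initSchedule L) L

section maxWeight

variable {net : Network N} {f : ℝ → ℝ} {π : net.MarkovPolicy}

theorem IsMaxWeight.le_maxWeight (hπ : net.IsMaxWeight f π) {S : Schedule N}
    (hS : S ∈ net.feasible) (L : PacketMatrix N) : fWeight f S L ≤ net.maxWeight f π L :=
  hπ _ net.initSchedule_mem L S hS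

/-- Ties may be broken according to the previous schedule, but the weight attained is always the
maximum; hence the use of `initSchedule` in `maxWeight` is immaterial. -/
theorem IsMaxWeight.fWeight_eq (hπ : net.IsMaxWeight f π) {s : Schedule N}
    (hs : s ∈ net.feasible) (L : PacketMatrix N) :
    fWeight f (π.toFun s L) L = net.maxWeight f π L :=
  (hπ.le_maxWeight (π.mem s hs L) L).antisymm
    (hπ s hs L _ (π.mem _ net.initSchedule_mem L))

theorem IsMaxWeight.maxWeight_nonneg (hπ : net.IsMaxWeight f π) (hf : ∀ x, 0 ≤ x → 0 ≤ f x)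
    (L : PacketMatrix N) : 0 ≤ net.maxWeight f π L := by
  refine le_trans ?_ (hπ.le_maxWeight net.initSchedule_mem L)
  rw [fWeight_eq_sum]
  exact Finset.sum_nonneg fun k _ =>
    mul_nonneg (hf _ (queueVec_nonneg L k)) (by split_ifs <;> norm_num)

theorem IsMaxWeight.le_maxWeight_of_served (hπ : net.IsMaxWeight f π) (hf : ∀ x, 0 ≤ x → 0 ≤ f x)
    {S : Schedule N} (hS : S ∈ net.feasible) {k : Fin N × Fin N} (hk : S k.1 k.2 = true)
    (L : PacketMatrix N) : f (queueVec L k) ≤ net.maxWeight f π L := by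
  refine le_trans ?_ (hπ.le_maxWeight hS L)
  rw [fWeight_eq_sum]
  refine le_trans (le_of_eq ?_) (Finset.single_le_sum (fun k _ =>
    mul_nonneg (hf _ (queueVec_nonneg L k)) (by split_ifs <;> norm_num)) (Finset.mem_univ k))
  simp [hk]

theorem IsMaxWeight.abs_maxWeight_sub_le (hπ : net.IsMaxWeight f π) {L L' : PacketMatrix N} {e : ℝ}
    (h : ∀ k, |f (queueVec L k) - f (queueVec L' k)| ≤ e) :
    |net.maxWeight f π L - net.maxWeight f π L'| ≤ Fintype.card (Fin N × Fin N) * e := by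
  have h1 := abs_le.1 (abs_fWeight_sub_le h (π.toFun net.initSchedule L))
  have h2 := abs_le.1 (abs_fWeight_sub_le h (π.toFun net.initSchedule L'))
  have h3 := hπ.le_maxWeight (π.mem _ net.initSchedule_mem L) L'
  have h4 := hπ.le_maxWeight (π.mem _ net.initSchedule_mem L') L
  rw [maxWeight] at h3 h4
  rw [abs_le, maxWeight, maxWeight]
  constructor <;> linarith [h1.1, h1.2, h2.1, h2.2]

end maxWeight

/-! ### Runs of Markov policies -/

theorem run_mem (net : Network N) (π : net.MarkovPolicy) (a : ℕ → PacketMatrix N) (t : ℕ) :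
    net.run π a t ∈ net.feasible := by
  induction t with
  | zero => rw [run_eq]; exact π.mem _ net.initSchedule_mem _
  | succ t ih => rw [run_eq]; exact π.mem _ ih _

theorem prevSchedule_run_mem (net : Network N) (π : net.MarkovPolicy) (a : ℕ → PacketMatrix N)
    (t : ℕ) : net.prevSchedule (net.run π a) t ∈ net.feasible := by
  cases t with
  | zero => exact net.initSchedule_mem
  | succ t => exact net.run_mem π a t

section bounds

variable (net : Network N) (s : ℕ → Schedule N) {a : ℕ → PacketMatrix N} {Amax : ℕ}

theorem queue_add_le (ha : ∀ t i j, a t i j ≤ Amax) (t n : ℕ) (i j : Fin N) :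
    net.queue s a (t + n) i j ≤ net.queue s a t i j + n * Amax := by
  induction n with
  | zero => simp
  | succ n ih =>
    have h1 := net.queue_succ_add s a (t + n) i j
    have h2 := ha (t + n) i j
    rw [← add_assoc, add_mul]
    omega

/-- With `1 ≤ Amax`, the constant that bounds the arrivals also bounds the departures, so it
controls changes in both directions. -/
theorem queue_le_add (hA : 1 ≤ Amax) (t n : ℕ) (i j : Fin N) :
    net.queue s a t i j ≤ net.queue s a (t + n) i j + n * Amax := by
  induction n with
  | zero => simp
  | succ n ih =>
    have h1 := net.queue_succ_add s a (t + n) i j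
    have h2 := net.departure_le s (t + n) (net.queue s a (t + n)) i j
    have h3 : (if s (t + n) i j = true then 1 else 0) ≤ 1 := by split_ifs <;> simp
    rw [← add_assoc, add_mul]
    omega

theorem abs_queueVec_sub_le (hA : 1 ≤ Amax) (ha : ∀ t i j, a t i j ≤ Amax) {T u v : ℕ}
    (huv : u ≤ v) (hT : v ≤ u + T) (k : Fin N × Fin N) :
    |queueVec (net.queue s a v) k - queueVec (net.queue s a u) k| ≤ (T * Amax : ℕ) := by
  obtain ⟨n, rfl⟩ := Nat.exists_eq_add_of_le huv
  have h1 := net.queue_add_le s ha u n k.1 k.2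
  have h2 := net.queue_le_add s (a := a) hA u n k.1 k.2
  have h3 : n * Amax ≤ T * Amax := Nat.mul_le_mul_right _ (by omega)
  have h4 : net.queue s a (u + n) k.1 k.2 ≤ net.queue s a u k.1 k.2 + T * Amax := by omega
  have h5 : net.queue s a u k.1 k.2 ≤ net.queue s a (u + n) k.1 k.2 + T * Amax := by omega
  have h6 : (net.queue s a (u + n) k.1 k.2 : ℝ) ≤ net.queue s a u k.1 k.2 + (T * Amax : ℕ) := by
    exact_mod_cast h4
  have h7 : (net.queue s a u k.1 k.2 : ℝ) ≤ net.queue s a (u + n) k.1 k.2 + (T * Amax : ℕ) := by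
    exact_mod_cast h5
  rw [abs_le]
  unfold queueVec
  constructor <;> linarith

theorem maxLength_le_add (hA : 1 ≤ Amax) {T u v : ℕ} (huv : u ≤ v) (hT : v ≤ u + T) :
    maxLength (net.queue s a u) ≤ maxLength (net.queue s a v) + T * Amax := by
  obtain ⟨n, rfl⟩ := Nat.exists_eq_add_of_le huv
  refine Finset.sup_le fun k _ => ?_
  have h2 := net.queue_le_add s (a := a) hA u n k.1 k.2
  have h3 : n * Amax ≤ T * Amax := Nat.mul_le_mul_right _ (by omega)
  have h4 := le_maxLength (net.queue s a (u + n)) k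
  omega

/-- A queue that no feasible schedule serves keeps its length if it receives no arrivals. -/
theorem queue_eq_initQueue {s : ℕ → Schedule N} (hs : ∀ t, s t ∈ net.feasible) {i j : Fin N}
    (hij : ∀ S ∈ net.feasible, S i j = false) (ha : ∀ t, a t i j = 0) (t : ℕ) :
    net.queue s a t i j = net.initQueue i j := by
  induction t with
  | zero => rfl
  | succ t ih =>
    have h1 := net.queue_succ_add s a t i j
    have h2 := net.departure_le s t (net.queue s a t) i j
    rw [hij _ (hs t)] at h2
    have h3 := ha t
    simp only [Bool.false_eq_true, if_false] at h2
    omega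

/-- A queue longer than all initial ones has grown, so some feasible schedule serves it, and that
schedule alone has weight at least its length to the power `α`. -/
theorem rpow_maxLength_le_maxWeight {α : ℝ} {π : net.MarkovPolicy}
    (hπ : net.IsMaxWeight (fun x => x ^ α) π) {s : ℕ → Schedule N} (hs : ∀ t, s t ∈ net.feasible)
    (ha0 : ∀ i j, (∀ S ∈ net.feasible, S i j = false) → ∀ t, a t i j = 0) {t : ℕ}
    (h : maxLength net.initQueue < maxLength (net.queue s a t)) :
    (maxLength (net.queue s a t) : ℝ) ^ α ≤ net.maxWeight (fun x => x ^ α) π (net.queue s a t) := by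
  obtain ⟨k, hk⟩ := exists_eq_maxLength ((Nat.zero_le _).trans_lt h)
  have hserved : ∃ S ∈ net.feasible, S k.1 k.2 = true := by
    by_contra! hno
    have hno' : ∀ S ∈ net.feasible, S k.1 k.2 = false := fun S hS => by simpa using hno S hS
    have h1 := net.queue_eq_initQueue hs hno' (ha0 _ _ hno') t
    have h2 := le_maxLength net.initQueue k
    omega
  obtain ⟨S, hS, hSk⟩ := hserved
  rw [← hk]
  exact hπ.le_maxWeight_of_served (fun x hx => Real.rpow_nonneg hx α) hS hSk _

end bounds

/-! ### Runs of adaptive policies -/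

section adaptive

variable {net : Network N} {f g : ℝ → ℝ} {π : net.MarkovPolicy}

theorem IsMaxWeight.le_fWeight_adaptive (hπ : net.IsMaxWeight f π) (hf : ∀ x, 0 ≤ x → 0 ≤ f x)
    (hg : ∀ x, 0 ≤ x → 0 ≤ g x) {s : Schedule N} (hs : s ∈ net.feasible) (L : PacketMatrix N) :
    net.maxWeight f π L - g (net.maxWeight f π L) ≤
      fWeight f ((net.adaptive g f π).toFun s L) L := by
  have h1 := hπ.fWeight_eq hs L
  simp only [adaptive, h1]
  split_ifs with h
  · linarith
  · rw [h1]
    linarith [hg _ (hπ.maxWeight_nonneg hf L)]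

theorem IsMaxWeight.adaptive_switch (hπ : net.IsMaxWeight f π) {s : Schedule N}
    (hs : s ∈ net.feasible) {L : PacketMatrix N} (h : (net.adaptive g f π).toFun s L ≠ s) :
    fWeight f ((net.adaptive g f π).toFun s L) L = net.maxWeight f π L ∧
      g (net.maxWeight f π L) < net.maxWeight f π L - fWeight f s L := by
  have h1 := hπ.fWeight_eq hs L
  simp only [adaptive, h1] at h ⊢
  split_ifs at h ⊢ with h2
  · exact absurd rfl h
  · exact ⟨h1, not_le.1 h2⟩

end adaptive

/-- A window in which at most one slot changes the schedule has few slots in reconfiguration. -/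
theorem card_inReconfiguration_le (net : Network N) {s : ℕ → Schedule N} {t T : ℕ}
    (h : ∀ u v, t ≤ u → u < v → v < t + T → s u ≠ net.prevSchedule s u →
      s v = net.prevSchedule s v) [DecidablePred (net.InReconfiguration s)] :
    ((Finset.Ico t (t + T)).filter (net.InReconfiguration s)).card ≤ 2 * (⌊net.delay⌋₊ + 1) := by
  have hfl : ∀ u τ : ℕ, u ≤ τ → (τ : ℝ) ≤ u + net.delay → τ < u + (⌊net.delay⌋₊ + 1) := by
    intro u τ h1 h2
    have h3 : τ - u ≤ ⌊net.delay⌋₊ := Nat.le_floor (by rw [Nat.cast_sub h1]; linarith)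
    omega
  -- Each change costs `⌊Δ_r⌋ + 1` slots, its own included. The first interval contains the
  -- aftermath of all changes before `t`, the second that of the only change `u` inside the window.
  have hsub : ∃ u, (Finset.Ico t (t + T)).filter (net.InReconfiguration s) ⊆
      Finset.Ico t (t + (⌊net.delay⌋₊ + 1)) ∪ Finset.Ico u (u + (⌊net.delay⌋₊ + 1)) := by
    by_cases hex : ∃ u, t ≤ u ∧ u < t + T ∧ s u ≠ net.prevSchedule s u
    · obtain ⟨u, hu1, hu2, hu3⟩ := hex
      refine ⟨u, fun τ hτ => ?_⟩
      obtain ⟨hτ1, v, hv1, hv2, hv3⟩ := Finset.mem_filter.1 hτ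
      rw [Finset.mem_Ico] at hτ1
      have h4 := hfl v τ hv1 hv2
      rw [Finset.mem_union, Finset.mem_Ico, Finset.mem_Ico]
      rcases lt_or_ge v t with hvt | hvt
      · left; omega
      · right
        have : v = u := by
          rcases lt_trichotomy u v with h5 | h5 | h5
          · exact absurd (h u v hu1 h5 (by omega) hu3) hv3
          · exact h5.symm
          · exact absurd (h v u hvt h5 hu2 hv3) hu3
        omega
    · push Not at hex
      refine ⟨t, fun τ hτ => ?_⟩
      obtain ⟨hτ1, v, hv1, hv2, hv3⟩ := Finset.mem_filter.1 hτ
      rw [Finset.mem_Ico] at hτ1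
      have h4 := hfl v τ hv1 hv2
      rw [Finset.mem_union, Finset.mem_Ico]
      rcases lt_or_ge v t with hvt | hvt
      · left; omega
      · exact absurd (hex v hvt (by omega)) hv3
  obtain ⟨u, hu⟩ := hsub
  refine (Finset.card_le_card hu).trans ((Finset.card_union_le _ _).trans ?_)
  simp only [Nat.card_Ico]
  omega

end Network

/-! ### The drift of the adaptive policy over a window -/

/-- The function `x ↦ x ^ α` varies by at most `δ * g (m ^ α)` over distances at most `C`, for
arguments of order at most `m`, provided that `m ≥ M`. -/
def SlowlyVarying (α : ℝ) (g : ℝ → ℝ) (C δ M : ℝ) : Prop :=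
  ∀ m ≥ M, ∀ x y : ℝ, 0 ≤ x → 0 ≤ y → x ≤ m + C → y ≤ m + C → |x - y| ≤ C →
    |x ^ α - y ^ α| ≤ δ * g (m ^ α)

theorem SlowlyVarying.abs_sub_le {N : ℕ} {α : ℝ} {g : ℝ → ℝ} {C δ M : ℝ}
    (h : SlowlyVarying α g C δ M) (hC : 0 ≤ C) {L L' : PacketMatrix N} (hM : M ≤ maxLength L)
    (hL : ∀ k, |queueVec L k - queueVec L' k| ≤ C) (k : Fin N × Fin N) :
    |queueVec L k ^ α - queueVec L' k ^ α| ≤ δ * g ((maxLength L : ℝ) ^ α) := by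
  have h1 := queueVec_le_maxLength L k
  have h2 := abs_le.1 (hL k)
  exact h _ hM _ _ (queueVec_nonneg L k) (queueVec_nonneg L' k) (by linarith)
    (by linarith [h2.1]) (hL k)

namespace Network

variable {N : ℕ} {net : Network N} {α : ℝ} {g : ℝ → ℝ} {π : net.MarkovPolicy}
  {a : ℕ → PacketMatrix N} {Amax T : ℕ} {δ M : ℝ}

/-- While the queues are long, two changes of the schedule are more than `T` slots apart. -/
theorem adaptive_no_second_switch (hg : IsHysteresis g)
    (hπ : net.IsMaxWeight (fun x => x ^ α) π) (hA : 1 ≤ Amax) (ha : ∀ t i j, a t i j ≤ Amax)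
    (ha0 : ∀ i j, (∀ S ∈ net.feasible, S i j = false) → ∀ t, a t i j = 0)
    (hsv : SlowlyVarying α g (T * Amax : ℕ) δ M)
    (hδ : 2 * Fintype.card (Fin N × Fin N) * δ ≤ 1)
    {s : ℕ → Schedule N} (hs : s = net.run (net.adaptive g (fun x => x ^ α) π) a) {t : ℕ}
    (hM : ∀ τ, t ≤ τ → τ < t + T → M ≤ maxLength (net.queue s a τ) ∧
      maxLength net.initQueue < maxLength (net.queue s a τ))
    {u : ℕ} (hu : t ≤ u) (hswitch : s u ≠ net.prevSchedule s u) {v : ℕ} (huv : u ≤ v)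
    (hv : v < t + T) : s v = s u := by
  have hmem : ∀ τ, s τ ∈ net.feasible := fun τ => hs ▸ net.run_mem _ a τ
  have hpmem : ∀ τ, net.prevSchedule s τ ∈ net.feasible := fun τ =>
    hs ▸ net.prevSchedule_run_mem _ a τ
  have hrun : ∀ τ, s τ = (net.adaptive g (fun x => x ^ α) π).toFun (net.prevSchedule s τ)
      (net.queue s a τ) := fun τ => by subst hs; exact net.run_eq _ a τ
  induction v, huv using Nat.le_induction with
  | base => rfl
  | succ v huv ih =>
    have ih := ih (by omega)
    have hprev : net.prevSchedule s (v + 1) = s u := ih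
    by_contra hne
    have h1 := hπ.adaptive_switch (hpmem (v + 1)) (g := g) (L := net.queue s a (v + 1))
      (by rw [← hrun, hprev]; exact hne)
    have h2 := hπ.adaptive_switch (hpmem u) (g := g) (L := net.queue s a u)
      (by rw [← hrun]; exact hswitch)
    rw [← hrun] at h2
    rw [hprev] at h1
    obtain ⟨hM1, hM2⟩ := hM (v + 1) (by omega) hv
    have hclose := hsv.abs_sub_le (Nat.cast_nonneg _) hM1 (L' := net.queue s a u) fun k =>
      net.abs_queueVec_sub_le s hA ha (T := T) (by omega) (by omega) k
    have h3 := abs_le.1 (hπ.abs_maxWeight_sub_le hclose)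
    have h4 := abs_le.1 (abs_fWeight_sub_le (f := fun x => x ^ α) hclose (s u))
    have h5 := net.rpow_maxLength_le_maxWeight hπ hmem ha0 hM2
    have h6 : (0 : ℝ) ≤ (maxLength (net.queue s a (v + 1)) : ℝ) ^ α := by positivity
    have h7 := hg.strictMonoOn.monotoneOn h6 (h6.trans h5) h5
    have h8 := hg.nonneg _ h6
    -- `s u` had maximal weight at `u`. Its weight and the maximal weight have each moved by at most
    -- `n δ g(m^α)` with `n` the number of pairs, so the deficit at `v + 1` is at most `2 n δ g(m^α)
    -- ≤ g(m^α) ≤ g(W)`: too small for a switch.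
    nlinarith [h1.2, h2.1, h3.2, h4.1, mul_le_mul_of_nonneg_right hδ h8]

open Classical in
/-- While the queues are long, every slot of a window that is not lost to reconfiguration serves
nearly the maximal weight. -/
theorem adaptive_service_ge (hα : 0 < α) (hg : IsHysteresis g)
    (hπ : net.IsMaxWeight (fun x => x ^ α) π) (hA : 1 ≤ Amax) (ha : ∀ t i j, a t i j ≤ Amax)
    (ha0 : ∀ i j, (∀ S ∈ net.feasible, S i j = false) → ∀ t, a t i j = 0)
    (hsv : SlowlyVarying α g (T * Amax : ℕ) δ M) (hδ0 : 0 ≤ δ) (hδ1 : δ ≤ 1)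
    (hgδ : ∀ m : ℝ, M ≤ m → ∀ y, m ^ α ≤ y → g y ≤ δ * y)
    {s : ℕ → Schedule N} (hs : s = net.run (net.adaptive g (fun x => x ^ α) π) a) {t : ℕ}
    (hM : ∀ τ, t ≤ τ → τ < t + T → M ≤ maxLength (net.queue s a τ) ∧
      maxLength net.initQueue < maxLength (net.queue s a τ))
    {τ : ℕ} (hτ1 : t ≤ τ) (hτ2 : τ < t + T) (hτ : ¬ net.InReconfiguration s τ) :
    (1 - (1 + 3 * Fintype.card (Fin N × Fin N)) * δ) *
        net.maxWeight (fun x => x ^ α) π (net.queue s a t) ≤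
      ∑ k, queueVec (net.queue s a t) k ^ α *
        net.departure s τ (net.queue s a τ) k.1 k.2 := by
  have hmem : ∀ τ, s τ ∈ net.feasible := fun τ => hs ▸ net.run_mem _ a τ
  have hpmem : ∀ τ, net.prevSchedule s τ ∈ net.feasible := fun τ =>
    hs ▸ net.prevSchedule_run_mem _ a τ
  have hrun : ∀ τ, s τ = (net.adaptive g (fun x => x ^ α) π).toFun (net.prevSchedule s τ)
      (net.queue s a τ) := fun τ => by subst hs; exact net.run_eq _ a τ
  have hf : ∀ x : ℝ, 0 ≤ x → 0 ≤ x ^ α := fun x hx => Real.rpow_nonneg hx α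
  obtain ⟨hM1, hM2⟩ := hM t le_rfl (by omega)
  obtain ⟨hM3, hM4⟩ := hM τ hτ1 hτ2
  have hdist := net.abs_queueVec_sub_le s hA ha (T := T) hτ1 hτ2.le
  have hclose := hsv.abs_sub_le (Nat.cast_nonneg _) hM1 (L' := net.queue s a τ) fun k =>
    (abs_sub_comm _ _).trans_le (hdist k)
  set X := net.queue s a t with hX
  set Y := net.queue s a τ with hY
  set n : ℝ := ((Fintype.card (Fin N × Fin N) : ℕ) : ℝ) with hn
  set G := g ((maxLength X : ℝ) ^ α) with hG
  have hW1 := net.rpow_maxLength_le_maxWeight hπ hmem ha0 hM2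
  have hW2 := net.rpow_maxLength_le_maxWeight hπ hmem ha0 hM4
  have hGle : G ≤ net.maxWeight (fun x => x ^ α) π X := by
    have := hgδ _ hM1 _ le_rfl
    have h0 : (0 : ℝ) ≤ (maxLength X : ℝ) ^ α := by positivity
    nlinarith
  have hG0 : 0 ≤ G := hg.nonneg _ (by positivity)
  have h1 := hπ.le_fWeight_adaptive hf hg.nonneg (hpmem τ) Y
  rw [hY, ← hrun, ← hY] at h1
  have h2 := hgδ _ hM3 _ hW2
  have h3 := (abs_le.1 (hπ.abs_maxWeight_sub_le hclose)).2
  have h4 := (abs_le.1 (abs_fWeight_sub_le (f := fun x => x ^ α) hclose (s τ))).1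
  -- A scheduled but empty queue has no departure. Being empty at `τ`, it was short at `t`, so its
  -- term is at most `δ * G`.
  have h5 : fWeight (fun x => x ^ α) (s τ) X ≤
      ∑ k, queueVec X k ^ α * net.departure s τ Y k.1 k.2 + n * (δ * G) := by
    rw [fWeight_eq_sum, hn, ← nsmul_eq_mul, ← Finset.card_univ, ← Finset.sum_const,
      ← Finset.sum_add_distrib]
    refine Finset.sum_le_sum fun k _ => ?_
    have hδG : 0 ≤ δ * G := mul_nonneg hδ0 hG0
    have hd : net.departure s τ Y k.1 k.2 = if s τ k.1 k.2 = true ∧ 0 < Y k.1 k.2 then 1 else 0 := by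
      simp [departure, hτ]
    rw [hd]
    by_cases hS : s τ k.1 k.2 = true
    · by_cases hq : 0 < Y k.1 k.2
      · simp [hS, hq, hδG]
      · have h0 : queueVec Y k = 0 := by
          simp only [queueVec]
          exact_mod_cast Nat.eq_zero_of_not_pos hq
        have h6 := (abs_le.1 (hclose k)).2
        rw [h0, Real.zero_rpow hα.ne', sub_zero] at h6
        simpa [hS, hq] using h6
    · simp [hS, hδG]
  have hW0 := hπ.maxWeight_nonneg hf X
  set W := net.maxWeight (fun x => x ^ α) π X with hW
  set W' := net.maxWeight (fun x => x ^ α) π Y with hW'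
  have hn0 : 0 ≤ n := Nat.cast_nonneg _
  have h7 : n * (δ * G) ≤ n * (δ * W) := by gcongr
  have h8 : (1 - δ) * (W - n * (δ * G)) ≤ (1 - δ) * W' :=
    mul_le_mul_of_nonneg_left (by linarith) (by linarith)
  have h9 : 0 ≤ δ * (n * (δ * G)) := by positivity
  -- The hysteresis costs a factor `1 - δ`. Comparing the maximal weights at `t` and `τ`, comparing
  -- the weights of `s τ`, and wasted service on empty queues cost `n δ G ≤ n δ W` each.
  nlinarith

open Classical in
/-- The drift of `∑ L_ij ^ (1 + α)` over a window, up to the fluctuations of the arrivals. -/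
theorem adaptive_window_drift (hα : 0 < α) (hg : IsHysteresis g)
    (hπ : net.IsMaxWeight (fun x => x ^ α) π) (hA : 1 ≤ Amax) (ha : ∀ t i j, a t i j ≤ Amax)
    (ha0 : ∀ i j, (∀ S ∈ net.feasible, S i j = false) → ∀ t, a t i j = 0)
    (hsv : SlowlyVarying α g (T * Amax : ℕ) δ M) (hδ0 : 0 ≤ δ) (hδ1 : δ ≤ 1)
    (hgδ : ∀ m : ℝ, M ≤ m → ∀ y, m ^ α ≤ y → g y ≤ δ * y)
    {r : ℝ} (hr0 : 0 < r) (hr : r < 1) {lam : Fin N × Fin N → ℝ}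
    (hlam : ∀ L : PacketMatrix N, ∑ k, queueVec L k ^ α * lam k ≤
      r * net.maxWeight (fun x => x ^ α) π L)
    (hδ : (1 + 3 * Fintype.card (Fin N × Fin N) + Fintype.card (Fin N × Fin N) * Amax) * δ ≤
      (1 - r) / 4)
    (hδ' : 2 * Fintype.card (Fin N × Fin N) * δ ≤ 1)
    (hT : 2 * ((⌊net.delay⌋₊ : ℝ) + 1) ≤ T * ((1 - r) / 4))
    {s : ℕ → Schedule N} (hs : s = net.run (net.adaptive g (fun x => x ^ α) π) a) {t : ℕ}
    (hM : ∀ τ, t ≤ τ → τ < t + T → M ≤ maxLength (net.queue s a τ) ∧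
      maxLength net.initQueue < maxLength (net.queue s a τ)) :
    ∑ k, queueVec (net.queue s a (t + T)) k ^ α *
        (queueVec (net.queue s a (t + T)) k - queueVec (net.queue s a t) k) ≤
      ∑ k, queueVec (net.queue s a t) k ^ α *
        ∑ τ ∈ Finset.Ico t (t + T), ((a τ k.1 k.2 : ℝ) - lam k) -
      T * ((1 - r) / 2) * (maxLength (net.queue s a t) : ℝ) ^ α := by
  have hmem : ∀ τ, s τ ∈ net.feasible := fun τ => hs ▸ net.run_mem _ a τ
  have hf : ∀ x : ℝ, 0 ≤ x → 0 ≤ x ^ α := fun x hx => Real.rpow_nonneg hx α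
  have hT0 : 0 < T := by
    rcases Nat.eq_zero_or_pos T with rfl | h
    · simp only [Nat.cast_zero, zero_mul] at hT
      have : (0 : ℝ) ≤ ⌊net.delay⌋₊ := Nat.cast_nonneg _
      linarith
    · exact h
  obtain ⟨hM1, hM2⟩ := hM t le_rfl (by omega)
  have hdist := net.abs_queueVec_sub_le s hA ha (T := T) (Nat.le_add_right t T) le_rfl
  have hclose := hsv.abs_sub_le (Nat.cast_nonneg _) hM1 (L' := net.queue s a (t + T)) fun k =>
    (abs_sub_comm _ _).trans_le (hdist k)
  have hserv : ∀ τ ∈ Finset.Ico t (t + T), ¬ net.InReconfiguration s τ → _ := fun τ hτ h =>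
    adaptive_service_ge hα hg hπ hA ha ha0 hsv hδ0 hδ1 hgδ hs hM (Finset.mem_Ico.1 hτ).1
      (Finset.mem_Ico.1 hτ).2 h
  have hlost := net.card_inReconfiguration_le (s := s) (t := t) (T := T) fun u v h1 h2 h3 h4 => by
    have h5 := adaptive_no_second_switch hg hπ hA ha ha0 hsv hδ' hs hM h1 h4 h2.le h3
    obtain ⟨v, rfl⟩ : ∃ w, v = w + 1 := ⟨v - 1, by omega⟩
    have h6 := adaptive_no_second_switch hg hπ hA ha ha0 hsv hδ' hs hM h1 h4
      (v := v) (by omega) (by omega)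
    rw [h5, ← h6]
    rfl
  have hinc : ∀ k : Fin N × Fin N, queueVec (net.queue s a (t + T)) k -
      queueVec (net.queue s a t) k = ∑ τ ∈ Finset.Ico t (t + T), ((a τ k.1 k.2 : ℝ) -
        net.departure s τ (net.queue s a τ) k.1 k.2) := fun k => by
    rw [← Finset.sum_Ico_sub (fun τ => queueVec (net.queue s a τ) k) (Nat.le_add_right t T)]
    refine Finset.sum_congr rfl fun τ _ => ?_
    have := net.queue_succ_add s a τ k.1 k.2
    have h' : (net.queue s a (τ + 1) k.1 k.2 : ℝ) +
      net.departure s τ (net.queue s a τ) k.1 k.2 = net.queue s a τ k.1 k.2 + a τ k.1 k.2 := by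
      exact_mod_cast this
    simp only [queueVec]
    linarith
  have hW1 := net.rpow_maxLength_le_maxWeight hπ hmem ha0 hM2
  have hW0 := hπ.maxWeight_nonneg hf (net.queue s a t)
  have hlamX := hlam (net.queue s a t)
  set X := net.queue s a t with hX
  set Y := net.queue s a (t + T) with hY
  set n : ℝ := ((Fintype.card (Fin N × Fin N) : ℕ) : ℝ) with hn
  set W := net.maxWeight (fun x => x ^ α) π X with hW
  set G := g ((maxLength X : ℝ) ^ α) with hG
  have hn0 : 0 ≤ n := Nat.cast_nonneg _
  have hGle : G ≤ W := by
    have := hgδ _ hM1 _ le_rfl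
    have h0 : (0 : ℝ) ≤ (maxLength X : ℝ) ^ α := by positivity
    nlinarith
  have hG0 : 0 ≤ G := hg.nonneg _ (by positivity)
  set κ := 1 - (1 + 3 * n) * δ with hκ
  have hκ0 : 0 ≤ κ := by
    have h1 : 0 ≤ n * Amax * δ := by positivity
    rw [hκ]
    linarith
  -- Weights are frozen at the start of the window, so that the coefficients of the arrivals depend
  -- only on the state at `t`.
  have hstep1 : ∑ k, queueVec Y k ^ α * (queueVec Y k - queueVec X k) ≤
      ∑ k, queueVec X k ^ α * (queueVec Y k - queueVec X k) + n * (δ * W * (T * Amax)) := by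
    rw [hn, ← nsmul_eq_mul, ← Finset.card_univ, ← Finset.sum_const, ← Finset.sum_add_distrib]
    refine Finset.sum_le_sum fun k _ => ?_
    have h1 : |(queueVec Y k ^ α - queueVec X k ^ α) * (queueVec Y k - queueVec X k)| ≤
        δ * W * (T * Amax) := by
      rw [abs_mul, abs_sub_comm (queueVec Y k ^ α)]
      have h2 := hdist k
      push_cast at h2
      refine mul_le_mul ((hclose k).trans ?_) h2 (abs_nonneg _) (by positivity)
      gcongr
    linarith [le_abs_self ((queueVec Y k ^ α - queueVec X k ^ α) * (queueVec Y k - queueVec X k))]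
  have hstep2 : ∑ k, queueVec X k ^ α * (queueVec Y k - queueVec X k) =
      ∑ k, queueVec X k ^ α * ∑ τ ∈ Finset.Ico t (t + T), ((a τ k.1 k.2 : ℝ) - lam k) +
      T * ∑ k, queueVec X k ^ α * lam k - ∑ τ ∈ Finset.Ico t (t + T),
        ∑ k, queueVec X k ^ α * net.departure s τ (net.queue s a τ) k.1 k.2 := by
    rw [Finset.sum_comm (s := Finset.Ico t (t + T)), Finset.mul_sum, ← Finset.sum_add_distrib,
      ← Finset.sum_sub_distrib]
    refine Finset.sum_congr rfl fun k _ => ?_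
    rw [hinc k, Finset.sum_sub_distrib, Finset.sum_sub_distrib, Finset.sum_const, Nat.card_Ico,
      ← Finset.mul_sum, Nat.add_sub_cancel_left, nsmul_eq_mul]
    ring
  have hstep3 : (T - 2 * ((⌊net.delay⌋₊ : ℝ) + 1)) * (κ * W) ≤ ∑ τ ∈ Finset.Ico t (t + T),
        ∑ k, queueVec X k ^ α * net.departure s τ (net.queue s a τ) k.1 k.2 := by
    rw [← Finset.sum_filter_add_sum_filter_not _ (net.InReconfiguration s)]
    have h1 : 0 ≤ ∑ τ ∈ (Finset.Ico t (t + T)).filter (net.InReconfiguration s),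
        ∑ k, queueVec X k ^ α * (net.departure s τ (net.queue s a τ) k.1 k.2 : ℝ) :=
      Finset.sum_nonneg fun τ _ => Finset.sum_nonneg fun k _ =>
        mul_nonneg (hf _ (queueVec_nonneg X k)) (Nat.cast_nonneg _)
    have h2 : (((Finset.Ico t (t + T)).filter fun τ => ¬ net.InReconfiguration s τ).card : ℝ) *
        (κ * W) ≤ ∑ τ ∈ (Finset.Ico t (t + T)).filter fun τ => ¬ net.InReconfiguration s τ,
        ∑ k, queueVec X k ^ α * (net.departure s τ (net.queue s a τ) k.1 k.2 : ℝ) := by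
      rw [← nsmul_eq_mul]
      refine Finset.card_nsmul_le_sum _ _ _ fun τ hτ => ?_
      exact hserv τ (Finset.mem_filter.1 hτ).1 (Finset.mem_filter.1 hτ).2
    have h3 := Finset.card_filter_add_card_filter_not (s := Finset.Ico t (t + T))
      (net.InReconfiguration s)
    rw [Nat.card_Ico, Nat.add_sub_cancel_left] at h3
    have h4 : (T : ℝ) - 2 * ((⌊net.delay⌋₊ : ℝ) + 1) ≤
        (((Finset.Ico t (t + T)).filter fun τ => ¬ net.InReconfiguration s τ).card : ℝ) := by
      have : T ≤ ((Finset.Ico t (t + T)).filter fun τ => ¬ net.InReconfiguration s τ).card +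
        2 * (⌊net.delay⌋₊ + 1) := by omega
      have : (T : ℝ) ≤ (((Finset.Ico t (t + T)).filter fun τ =>
        ¬ net.InReconfiguration s τ).card : ℝ) + 2 * ((⌊net.delay⌋₊ : ℝ) + 1) := by
        exact_mod_cast this
      linarith
    have h5 := mul_le_mul_of_nonneg_right h4 (mul_nonneg hκ0 hW0)
    linarith
  have hTr : (0 : ℝ) < T := by exact_mod_cast hT0
  have h6 : (T : ℝ) * ∑ k, queueVec X k ^ α * lam k ≤ T * (r * W) := by gcongr
  have h7 : (T : ℝ) * ((1 + 3 * n + n * Amax) * δ) * W ≤ T * ((1 - r) / 4) * W := by gcongr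
  have h8 : 2 * ((⌊net.delay⌋₊ : ℝ) + 1) * W ≤ T * ((1 - r) / 4) * W := by gcongr
  have h9 : (T : ℝ) * ((1 - r) / 2) * (maxLength X : ℝ) ^ α ≤ T * ((1 - r) / 2) * W :=
    mul_le_mul_of_nonneg_left hW1 (mul_nonneg hTr.le (by linarith))
  have h10 : 0 ≤ 2 * ((⌊net.delay⌋₊ : ℝ) + 1) * ((1 + 3 * n) * δ) * W := by positivity
  rw [hκ] at hstep3
  -- Of the gain `(1 - r) T W`, one quarter pays for the lost slots and one quarter for all errors
  -- of order `δ`; half remains.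
  nlinarith

end Network

/-! ### Choice of the constants and drift of the squared norm -/

namespace Network

variable {N : ℕ}

/-- The drift of the squared `ℓ^(1+α)` norm of the queue lengths over windows of a fixed length, up
to fluctuations of the arrivals that have zero mean given the state. -/
theorem exists_adaptive_drift (net : Network N) {α : ℝ} (hα : 0 < α) {g : ℝ → ℝ}
    (hg : IsHysteresis g) (hg_top : Tendsto g atTop atTop)
    (hgα : Tendsto (fun x : ℝ => x ^ (α - 1) / g (x ^ α)) atTop (𝓝 0))
    {π : net.MarkovPolicy} (hπ : net.IsMaxWeight (fun x => x ^ α) π) {Amax : ℕ} (hA : 1 ≤ Amax)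
    {r : ℝ} (hr0 : 0 < r) (hr : r < 1) {lam : Fin N × Fin N → ℝ}
    (hlam : ∀ L : PacketMatrix N, ∑ k, queueVec L k ^ α * lam k ≤
      r * net.maxWeight (fun x => x ^ α) π L) :
    ∃ (T : ℕ) (ε C : ℝ) (w : PacketMatrix N → Fin N × Fin N → ℝ), 0 < ε ∧ 0 ≤ C ∧
      ∀ a : ℕ → PacketMatrix N, (∀ t i j, a t i j ≤ Amax) →
      (∀ i j, (∀ S ∈ net.feasible, S i j = false) → ∀ t, a t i j = 0) →
      ∀ t, lpSize (1 + α) (queueVec (net.queue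
          (net.run (net.adaptive g (fun x => x ^ α) π) a) a (t + T))) ^ 2 ≤
        lpSize (1 + α) (queueVec (net.queue
          (net.run (net.adaptive g (fun x => x ^ α) π) a) a t)) ^ 2 + C -
        ε * lpSize (1 + α) (queueVec (net.queue
          (net.run (net.adaptive g (fun x => x ^ α) π) a) a t)) +
        ∑ k, w (net.queue (net.run (net.adaptive g (fun x => x ^ α) π) a) a t) k *
          ∑ τ ∈ Finset.Ico t (t + T), ((a τ k.1 k.2 : ℝ) - lam k) := by
  set n : ℝ := ((Fintype.card (Fin N × Fin N) : ℕ) : ℝ) with hn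
  have hn0 : 0 ≤ n := Nat.cast_nonneg _
  have hAr : (1 : ℝ) ≤ Amax := by exact_mod_cast hA
  obtain ⟨T, hT⟩ := exists_nat_ge (2 * ((⌊net.delay⌋₊ : ℝ) + 1) / ((1 - r) / 4))
  rw [div_le_iff₀ (by linarith)] at hT
  have hT0 : 0 < T := by
    rcases Nat.eq_zero_or_pos T with rfl | h
    · simp only [Nat.cast_zero, zero_mul] at hT
      have : (0 : ℝ) ≤ ⌊net.delay⌋₊ := Nat.cast_nonneg _
      linarith
    · exact h
  have hTr : (0 : ℝ) < T := by exact_mod_cast hT0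
  -- `δ` does not depend on `T`, while the distance `C` moved in a window does; the threshold `M` is
  -- chosen after both.
  set δ : ℝ := (1 - r) / 4 / (1 + 3 * n + n * Amax) with hδdef
  have hden : 0 < 1 + 3 * n + n * Amax := by positivity
  have hδ0 : 0 < δ := div_pos (by linarith) hden
  have hδ : (1 + 3 * n + n * Amax) * δ = (1 - r) / 4 := mul_div_cancel₀ _ hden.ne'
  have hnd : 0 ≤ n * δ := by positivity
  have hnd' : 0 ≤ n * Amax * δ := by positivity
  have hδ1 : δ ≤ 1 := by nlinarith
  have hδ' : 2 * n * δ ≤ 1 := by nlinarith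
  set C : ℝ := ((T * Amax : ℕ) : ℝ) with hCdef
  have hC : 0 < C := by
    rw [hCdef]
    exact_mod_cast Nat.mul_pos hT0 hA
  obtain ⟨M1, hM1⟩ := exists_abs_rpow_sub_rpow_le hα hg_top hgα hC hδ0
  obtain ⟨y0, hy0⟩ := eventually_atTop.1
    ((hg.sublinear.eventually_le_const hδ0).and (eventually_gt_atTop 0))
  obtain ⟨M2, hM2⟩ := eventually_atTop.1 ((tendsto_rpow_atTop hα).eventually_ge_atTop y0)
  set M := max M1 M2 with hM
  have hsv : SlowlyVarying α g C δ M := fun m hm => hM1 m ((le_max_left _ _).trans hm)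
  have hgδ : ∀ m : ℝ, M ≤ m → ∀ y, m ^ α ≤ y → g y ≤ δ * y := fun m hm y hy => by
    have h1 := hy0 y ((hM2 m ((le_max_right _ _).trans hm)).trans hy)
    exact (div_le_iff₀ h1.2).1 h1.1
  -- The longest queue loses at most `C` in a window, so starting from `B` it stays above `M` and
  -- above the initial lengths.
  set B : ℝ := max M (maxLength net.initQueue + 1) + C with hB
  have hBM : M + C ≤ B := by rw [hB]; gcongr; exact le_max_left _ _
  have hBi : (maxLength net.initQueue : ℝ) + 1 + C ≤ B := by rw [hB]; gcongr; exact le_max_right _ _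
  have hB0 : 0 < B := by
    have : (0 : ℝ) ≤ maxLength net.initQueue := Nat.cast_nonneg _
    linarith
  set η : ℝ := T * ((1 - r) / 2) with hη
  have hη0 : 0 < η := mul_pos hTr (by linarith)
  set p : ℝ := 1 + α with hp
  have hp1 : 1 ≤ p := by linarith
  set C1 := lpSize p (fun _ : Fin N × Fin N => C) with hC1
  set ΦB := lpSize p (fun _ : Fin N × Fin N => B) with hΦB
  have hC10 : 0 ≤ C1 := lpSize_nonneg fun _ => hC.le
  have hΦB0 : 0 ≤ ΦB := lpSize_nonneg fun _ => hB0.le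
  -- `n + 1` instead of `n` avoids division by zero when there are no switches.
  set ε : ℝ := 2 * (η / (n + 1)) with hε
  have hε0 : 0 < ε := by positivity
  classical
  -- For long queues `w` is the gradient of the squared norm and `C1 ^ 2` the second-order error.
  -- For short queues the norm is at most `ΦB` and grows by at most `C1`, which the remaining terms
  -- of the constant cover without any drift.
  refine ⟨T, ε, C1 ^ 2 + 2 * ΦB * C1 + ε * ΦB, fun L k =>
    if B ≤ maxLength L then 2 * (lpSize p (queueVec L) ^ 2 / ∑ k, queueVec L k ^ p) *
      queueVec L k ^ α else 0, hε0, by positivity, fun a ha ha0 t => ?_⟩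
  generalize hs : net.run (net.adaptive g (fun x => x ^ α) π) a = s
  have hdist := net.abs_queueVec_sub_le s hA ha (T := T) (Nat.le_add_right t T) le_rfl
  have hdrift := fun hM => adaptive_window_drift hα hg hπ hA ha ha0 hsv hδ0.le hδ1 hgδ hr0 hr hlam
    hδ.le hδ' hT hs.symm (t := t) hM
  have hlen : ∀ τ, t ≤ τ → τ < t + T → (maxLength (net.queue s a t) : ℝ) ≤
      maxLength (net.queue s a τ) + C := fun τ h1 h2 => by
    rw [hCdef]
    exact_mod_cast net.maxLength_le_add s (a := a) hA h1 h2.le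
  set X := net.queue s a t with hX
  set Y := net.queue s a (t + T) with hY
  have hx0 := queueVec_nonneg X
  have hy0' := queueVec_nonneg Y
  have hΦ0 : 0 ≤ lpSize p (queueVec X) := lpSize_nonneg hx0
  by_cases hbig : B ≤ maxLength X
  · have hm0 : (0 : ℝ) < maxLength X := hB0.trans_le hbig
    have hd := hdrift fun τ h1 h2 => by
      have := hlen τ h1 h2
      refine ⟨by linarith, ?_⟩
      have : (maxLength net.initQueue : ℝ) < maxLength (net.queue s a τ) := by linarith
      exact_mod_cast this
    obtain ⟨k0, hk0⟩ := exists_eq_maxLength (by exact_mod_cast hm0 : 0 < maxLength X)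
    have hk0' : queueVec X k0 = maxLength X := by simp only [queueVec, hk0]
    have hV : 0 < ∑ k, queueVec X k ^ p :=
      Finset.sum_pos' (fun k _ => Real.rpow_nonneg (hx0 k) p)
        ⟨k0, Finset.mem_univ _, Real.rpow_pos_of_pos (hk0' ▸ hm0) p⟩
    have hΦpos : 0 < lpSize p (queueVec X) := Real.rpow_pos_of_pos hV _
    have hsq := sq_lpSize_le hp1 hx0 hy0' hC.le hdist hV
    -- Bounding `x^p = x^α x` by `m^α Φ` converts the drift `m^α Φ² / ∑ x^p` into a multiple of `Φ`.
    have hVle : ∑ k, queueVec X k ^ p ≤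
        (maxLength X : ℝ) ^ α * ((n + 1) * lpSize p (queueVec X)) := by
      have h1 : ∀ k ∈ Finset.univ, queueVec X k ^ p ≤
          (maxLength X : ℝ) ^ α * lpSize p (queueVec X) := fun k _ => by
        have h0 : queueVec X k ^ p = queueVec X k ^ α * queueVec X k := by
          rw [hp, add_comm, Real.rpow_add_one' (hx0 k) (by linarith)]
        rw [h0]
        exact mul_le_mul (Real.rpow_le_rpow (hx0 k) (queueVec_le_maxLength X k) hα.le)
          (le_lpSize hp1 hx0 k) (hx0 k) (by positivity)
      have h2 := Finset.sum_le_card_nsmul _ _ _ h1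
      rw [Finset.card_univ, nsmul_eq_mul, ← hn] at h2
      have h3 : 0 ≤ (maxLength X : ℝ) ^ α * lpSize p (queueVec X) := by positivity
      linarith
    have hc : η / (n + 1) * lpSize p (queueVec X) ≤
        lpSize p (queueVec X) ^ 2 / (∑ k, queueVec X k ^ p) * (η * (maxLength X : ℝ) ^ α) := by
      rw [div_mul_eq_mul_div, div_mul_eq_mul_div, div_le_div_iff₀ (by positivity) hV]
      calc η * lpSize p (queueVec X) * ∑ k, queueVec X k ^ p ≤ η * lpSize p (queueVec X) *
            ((maxLength X : ℝ) ^ α * ((n + 1) * lpSize p (queueVec X))) := by gcongr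
        _ = _ := by ring
    simp only [hbig, if_true, mul_assoc, ← Finset.mul_sum]
    set c := lpSize p (queueVec X) ^ 2 / ∑ k, queueVec X k ^ p with hcdef
    have hc0 : 0 ≤ c := by positivity
    rw [show p - 1 = α by rw [hp]; ring] at hsq
    have hd' := mul_le_mul_of_nonneg_left hd hc0
    rw [← hη] at hd'
    rw [← hC1] at hsq
    have h1 : 0 ≤ ΦB * C1 := mul_nonneg hΦB0 hC10
    have h2 : 0 ≤ ε * ΦB := mul_nonneg hε0.le hΦB0
    rw [hε]
    rw [hε] at h2
    linarith
  · have h1 := lpSize_le_add hp1 hx0 hy0' hC.le hdist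
    have h2 : lpSize p (queueVec X) ≤ ΦB := lpSize_mono hp1 hx0 fun k =>
      (queueVec_le_maxLength X k).trans (not_le.1 hbig).le
    have h3 : 0 ≤ lpSize p (queueVec Y) := lpSize_nonneg hy0'
    simp only [hbig, if_false, zero_mul, Finset.sum_const_zero, add_zero]
    rw [← hC1] at h1
    have h4 : lpSize p (queueVec Y) ^ 2 ≤ (lpSize p (queueVec X) + C1) ^ 2 :=
      pow_le_pow_left₀ h3 h1 2
    have h5 := mul_le_mul_of_nonneg_right h2 hC10
    have h6 := mul_le_mul_of_nonneg_left h2 hε0.le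
    nlinarith

end Network

/-! ### The queue lengths as random variables -/

namespace Network

variable {N : ℕ}

/-- Causality. Schedules and queues need a joint induction: each schedule depends on the current
queues, and the departures on all schedules so far through the reconfigurations. -/
theorem run_congr (net : Network N) (π : net.MarkovPolicy) {a a' : ℕ → PacketMatrix N} {t : ℕ}
    (h : ∀ u < t, a u = a' u) : (∀ u < t, net.run π a u = net.run π a' u) ∧
      net.queue (net.run π a) a t = net.queue (net.run π a') a' t := by
  induction t with
  | zero => exact ⟨fun u hu => absurd hu (Nat.not_lt_zero u), rfl⟩
  | succ t ih =>
    obtain ⟨h1, h2⟩ := ih fun u hu => h u (hu.trans (Nat.lt_succ_self t))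
    have h3 : net.run π a t = net.run π a' t := by
      rw [net.run_eq, net.run_eq π a', h2, net.prevSchedule_congr h1]
    have h4 : ∀ u < t + 1, net.run π a u = net.run π a' u := fun u hu => by
      rcases Nat.lt_succ_iff_lt_or_eq.1 hu with h' | rfl
      · exact h1 u h'
      · exact h3
    refine ⟨h4, ?_⟩
    have h5 := propext (net.inReconfiguration_congr (s := net.run π a) (s' := net.run π a') (t := t)
      fun u hu => h4 u (Nat.lt_succ_of_le hu))
    funext i j
    simp only [queue, departure]
    rw [h2, h5, h3, h t (Nat.lt_succ_self t)]

section random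

variable {Ω : Type*} [MeasurableSpace Ω] {P : Measure Ω} {A : ℕ → Ω → PacketMatrix N}

/-- The queue lengths at the beginning of slot `t` depend only on the arrivals before slot `t`. -/
theorem exists_queue_eq_history (net : Network N) (π : net.MarkovPolicy) (t : ℕ) :
    ∃ G : ((Finset.range t ×ˢ (Finset.univ : Finset (Fin N × Fin N)) : Finset (ℕ × Fin N × Fin N)) →
      ℕ) → PacketMatrix N, ∀ a : ℕ → PacketMatrix N,
      net.queue (net.run π a) a t = G fun k => a k.1.1 k.1.2.1 k.1.2.2 := by
  classical
  refine ⟨fun h => net.queue (net.run π fun u i j => if hu : (u, i, j) ∈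
    (Finset.range t ×ˢ (Finset.univ : Finset (Fin N × Fin N))) then h ⟨_, hu⟩ else 0)
    (fun u i j => if hu : (u, i, j) ∈
    (Finset.range t ×ˢ (Finset.univ : Finset (Fin N × Fin N))) then h ⟨_, hu⟩ else 0) t,
    fun a => (net.run_congr π fun u hu => ?_).2⟩
  funext i j
  simp [hu]

theorem _root_.IsTraffic.measurable_entry (hA : IsTraffic P A) (t : ℕ) (i j : Fin N) :
    Measurable fun ω => A t ω i j :=
  (measurable_pi_apply j).comp ((measurable_pi_apply i).comp (hA.measurable t))

theorem measurable_queue_run (net : Network N) (π : net.MarkovPolicy) (hA : IsTraffic P A) (t : ℕ) :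
    Measurable fun ω => net.queue (net.run π fun u => A u ω) (fun u => A u ω) t := by
  obtain ⟨G, hG⟩ := net.exists_queue_eq_history π t
  simp_rw [hG]
  exact (Measurable.of_discrete (f := G)).comp
    (measurable_pi_lambda _ fun k => hA.measurable_entry k.1.1 k.1.2.1 k.1.2.2)

theorem indepFun_queue_run (net : Network N) (π : net.MarkovPolicy) (hA : IsTraffic P A) {t τ : ℕ}
    (h : t ≤ τ) (i j : Fin N) :
    IndepFun (fun ω => net.queue (net.run π fun u => A u ω) (fun u => A u ω) t)
      (fun ω => A τ ω i j) P := by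
  obtain ⟨G, hG⟩ := net.exists_queue_eq_history π t
  simp_rw [hG]
  have hdisj : Disjoint (Finset.range t ×ˢ (Finset.univ : Finset (Fin N × Fin N)))
      {(τ, i, j)} := by
    simp [h]
  have := hA.indep.indepFun_finset _ _ hdisj fun k => hA.measurable_entry k.1 k.2.1 k.2.2
  exact this.comp (φ := G) (ψ := fun f => f ⟨(τ, i, j), Finset.mem_singleton_self _⟩)
    Measurable.of_discrete Measurable.of_discrete

theorem integral_entry (hA : IsTraffic P A) (t : ℕ) (i j : Fin N) :
    ∫ ω, (A t ω i j : ℝ) ∂P = trafficRate P A i j :=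
  ((hA.identDistrib t i j).comp (measurable_from_nat (f := fun n : ℕ => (n : ℝ)))).integral_eq

variable [IsProbabilityMeasure P] {Amax : ℕ}

/-- No growth condition on `h` is needed: with bounded arrivals the queues at a fixed time range
over a finite box. -/
theorem integrable_comp_queue_run (net : Network N) (π : net.MarkovPolicy) (hA : IsTraffic P A)
    (hb : ∀ᵐ ω ∂P, ∀ t i j, A t ω i j ≤ Amax) (t : ℕ) (h : PacketMatrix N → ℝ) :
    Integrable (fun ω => h (net.queue (net.run π fun u => A u ω) (fun u => A u ω) t)) P := by
  classical
  have hfin : (Set.Icc (0 : PacketMatrix N) fun i j => net.initQueue i j + t * Amax).Finite :=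
    Set.finite_Icc _ _
  obtain ⟨C, hC⟩ := (hfin.image fun L => ‖h L‖).bddAbove
  refine Integrable.of_bound ((Measurable.of_discrete (f := h)).comp
    (net.measurable_queue_run π hA t)).aestronglyMeasurable C ?_
  filter_upwards [hb] with ω hω
  refine hC (Set.mem_image_of_mem (fun L => ‖h L‖) ⟨fun i j => Nat.zero_le _, fun i j => ?_⟩)
  have := net.queue_add_le (net.run π fun u => A u ω) (a := fun u => A u ω) hω 0 t i j
  rwa [zero_add] at this

theorem integrable_entry (hA : IsTraffic P A) (hb : ∀ᵐ ω ∂P, ∀ t i j, A t ω i j ≤ Amax) (t : ℕ)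
    (i j : Fin N) : Integrable (fun ω => (A t ω i j : ℝ)) P := by
  refine Integrable.of_bound ((measurable_from_nat (f := fun n : ℕ => (n : ℝ))).comp
    (hA.measurable_entry t i j)).aestronglyMeasurable Amax ?_
  filter_upwards [hb] with ω hω
  simpa using hω t i j

/-- The future arrivals fluctuate with zero mean given the state. -/
theorem integrable_fluctuation (net : Network N) (π : net.MarkovPolicy) (hA : IsTraffic P A)
    (hb : ∀ᵐ ω ∂P, ∀ t i j, A t ω i j ≤ Amax) {t τ : ℕ} (hτ : t ≤ τ) (h : PacketMatrix N → ℝ)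
    (i j : Fin N) :
    Integrable (fun ω => h (net.queue (net.run π fun u => A u ω) (fun u => A u ω) t) *
      ((A τ ω i j : ℝ) - trafficRate P A i j)) P ∧
    ∫ ω, h (net.queue (net.run π fun u => A u ω) (fun u => A u ω) t) *
      ((A τ ω i j : ℝ) - trafficRate P A i j) ∂P = 0 := by
  have h1 := net.integrable_comp_queue_run π hA hb t h
  have h2 : Integrable (fun ω => (A τ ω i j : ℝ) - trafficRate P A i j) P :=
    (integrable_entry hA hb τ i j).sub (integrable_const _)
  have h3 : IndepFun (fun ω => h (net.queue (net.run π fun u => A u ω) (fun u => A u ω) t))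
      (fun ω => (A τ ω i j : ℝ) - trafficRate P A i j) P :=
    (net.indepFun_queue_run π hA hτ i j).comp (φ := h)
      (ψ := fun n : ℕ => (n : ℝ) - trafficRate P A i j) Measurable.of_discrete
      Measurable.of_discrete
  refine ⟨h3.integrable_mul h1 h2, ?_⟩
  rw [h3.integral_fun_mul_eq_mul_integral h1.aestronglyMeasurable h2.aestronglyMeasurable,
    integral_sub (integrable_entry hA hb τ i j) (integrable_const _), integral_entry hA]
  simp

theorem ae_entry_eq_zero (hA : IsTraffic P A) (hb : ∀ᵐ ω ∂P, ∀ t i j, A t ω i j ≤ Amax)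
    {i j : Fin N} (h : trafficRate P A i j ≤ 0) : ∀ᵐ ω ∂P, ∀ t, A t ω i j = 0 := by
  refine ae_all_iff.2 fun t => ?_
  have h1 : ∫ ω, (A t ω i j : ℝ) ∂P = 0 :=
    le_antisymm ((integral_entry hA t i j).trans_le h) (integral_nonneg fun ω => Nat.cast_nonneg _)
  have h2 := (integral_eq_zero_iff_of_nonneg (fun ω => Nat.cast_nonneg _)
    (integrable_entry hA hb t i j)).1 h1
  filter_upwards [h2] with ω hω
  simpa using hω

end random

end Network

/-! ### From the drift inequality to strong stability -/

theorem totalLength_le_lpSize {N : ℕ} {p : ℝ} (hp : 1 ≤ p) (L : PacketMatrix N) :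
    (totalLength L : ℝ) ≤ Fintype.card (Fin N × Fin N) * lpSize p (queueVec L) := by
  have h : (totalLength L : ℝ) = ∑ k, queueVec L k := by
    rw [totalLength, ← Fintype.sum_prod_type' (f := fun i j => L i j)]
    push_cast
    rfl
  rw [h, ← nsmul_eq_mul, ← Finset.card_univ]
  exact Finset.sum_le_card_nsmul _ _ _ fun k _ => le_lpSize hp (queueVec_nonneg L) k

/-- A drift inequality over windows of length `T` bounds the averages of the drift. -/
theorem sum_le_of_window_drift {y z : ℕ → ℝ} (hy : ∀ t, 0 ≤ y t) {T : ℕ} {ε C : ℝ}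
    (h : ∀ t, y (t + T) ≤ y t + C - ε * z t) (n : ℕ) :
    ε * ∑ t ∈ Finset.range n, z t ≤ ∑ t ∈ Finset.range T, y t + n * C := by
  have h1 : ∑ t ∈ Finset.range n, y (t + T) ≤ ∑ t ∈ Finset.range n, (y t + C - ε * z t) :=
    Finset.sum_le_sum fun t _ => h t
  -- The windows overlap, one starting at each slot; shifting the sum by `T` leaves only its first
  -- `T` terms as boundary.
  have h2 : ∑ t ∈ Finset.range n, y t ≤ ∑ t ∈ Finset.range (T + n), y t :=
    Finset.sum_le_sum_of_subset_of_nonneg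
      (fun t ht => Finset.mem_range.2 (by have := Finset.mem_range.1 ht; omega)) fun t _ _ => hy t
  rw [Finset.sum_range_add] at h2
  simp_rw [add_comm T] at h2
  rw [Finset.sum_sub_distrib, Finset.sum_add_distrib, ← Finset.mul_sum] at h1
  simp only [Finset.sum_const, Finset.card_range, nsmul_eq_mul] at h1
  linarith

theorem mainTheorem4 {N : ℕ} (net : Network N) (α : ℝ) (hα : 0 < α)
    (g : ℝ → ℝ) (hg : IsHysteresis g) (hg_top : Tendsto g atTop atTop)
    (hgα : Tendsto (fun x : ℝ => x ^ (α - 1) / g (x ^ α)) atTop (𝓝 0))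
    (π : net.MarkovPolicy) (hπ : net.IsMaxWeight (fun x => x ^ α) π) :
    net.ThroughputOptimal (net.adaptive g (fun x => x ^ α) π) := by
  intro Ω _ P _ A hA ⟨A0, hA0⟩ hload
  obtain ⟨r, hr0, hr, hcap⟩ := net.exists_lt_one_weight_le_of_load_lt_one hload
  -- The bound is raised by one so that it is at least `1` and also dominates the departures.
  have hb : ∀ᵐ ω ∂P, ∀ t i j, A t ω i j ≤ A0 + 1 := by
    refine ae_all_iff.2 fun t => ae_all_iff.2 fun i => ae_all_iff.2 fun j => ?_
    filter_upwards [hA0 t i j] with ω hω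
    omega
  have hlam : ∀ L : PacketMatrix N, ∑ k, queueVec L k ^ α * trafficRate P A k.1 k.2 ≤
      r * net.maxWeight (fun x => x ^ α) π L := fun L =>
    hcap (fun k => queueVec L k ^ α) (fun k => Real.rpow_nonneg (queueVec_nonneg L k) α) _
      fun S hS => (fWeight_eq_sum _ S L).symm.trans_le (hπ.le_maxWeight hS L)
  -- Testing the capacity bound with the indicator of an unserved pair and `H = 0` shows that its
  -- rate vanishes, hence almost surely its arrivals.
  have hzero : ∀ᵐ ω ∂P, ∀ i j, (∀ S ∈ net.feasible, S i j = false) → ∀ t, A t ω i j = 0 := by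
    refine ae_all_iff.2 fun i => ae_all_iff.2 fun j => ?_
    by_cases hij : ∀ S ∈ net.feasible, S i j = false
    · have h1 : trafficRate P A i j ≤ 0 := by
        have := hcap (Pi.single (i, j) 1) (Pi.single_nonneg.2 zero_le_one) 0 fun S hS => by
          refine (Finset.sum_eq_zero fun k _ => ?_).le
          by_cases hk : k = (i, j)
          · simp [hk, hij S hS]
          · simp [hk]
        simpa [Pi.single_apply] using this
      filter_upwards [Network.ae_entry_eq_zero hA hb h1] with ω hω
      exact fun _ => hω
    · exact ae_of_all _ fun ω h => absurd h hij
  obtain ⟨T, ε, C, w, hε, hC, hdrift⟩ := net.exists_adaptive_drift hα hg hg_top hgα hπ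
    (Nat.le_add_left 1 A0) hr0 hr hlam
  set ρ := net.adaptive g (fun x => x ^ α) π with hρ
  set X : ℕ → Ω → PacketMatrix N := fun t ω =>
    net.queue (net.run ρ fun u => A u ω) (fun u => A u ω) t with hX
  set Φ : ℕ → Ω → ℝ := fun t ω => lpSize (1 + α) (queueVec (X t ω)) with hΦ
  have hint : ∀ t (h : PacketMatrix N → ℝ), Integrable (fun ω => h (X t ω)) P :=
    net.integrable_comp_queue_run ρ hA hb
  have hΦint : ∀ t, Integrable (Φ t) P := fun t => hint t fun L => lpSize (1 + α) (queueVec L)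
  have hΦ2int : ∀ t, Integrable (fun ω => Φ t ω ^ 2) P := fun t =>
    hint t fun L => lpSize (1 + α) (queueVec L) ^ 2
  have hΦ0 : ∀ t ω, 0 ≤ Φ t ω := fun t ω => lpSize_nonneg (queueVec_nonneg _)
  have hwindow : ∀ t, ∫ ω, Φ (t + T) ω ^ 2 ∂P ≤
      ∫ ω, Φ t ω ^ 2 ∂P + C - ε * ∫ ω, Φ t ω ∂P := by
    intro t
    have hfl : ∀ k : Fin N × Fin N, ∀ τ ∈ Finset.Ico t (t + T), _ := fun k τ hτ =>
      net.integrable_fluctuation ρ hA hb (Finset.mem_Ico.1 hτ).1 (fun L => w L k) k.1 k.2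
    have hi : Integrable (fun ω => ∑ k : Fin N × Fin N, ∑ τ ∈ Finset.Ico t (t + T),
        w (X t ω) k * ((A τ ω k.1 k.2 : ℝ) - trafficRate P A k.1 k.2)) P :=
      integrable_finsetSum _ fun k _ => integrable_finsetSum _ fun τ hτ => (hfl k τ hτ).1
    have hi0 : ∫ ω, ∑ k : Fin N × Fin N, ∑ τ ∈ Finset.Ico t (t + T),
        w (X t ω) k * ((A τ ω k.1 k.2 : ℝ) - trafficRate P A k.1 k.2) ∂P = 0 := by
      rw [integral_finsetSum _ fun k _ => integrable_finsetSum _ fun τ hτ => (hfl k τ hτ).1]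
      refine Finset.sum_eq_zero fun k _ => ?_
      rw [integral_finsetSum _ fun τ hτ => (hfl k τ hτ).1]
      exact Finset.sum_eq_zero fun τ hτ => (hfl k τ hτ).2
    have hiC : Integrable (fun ω => Φ t ω ^ 2 + C) P := (hΦ2int t).add (integrable_const C)
    have hi1 : Integrable (fun ω => Φ t ω ^ 2 + C - ε * Φ t ω) P :=
      hiC.sub ((hΦint t).const_mul ε)
    have hle : ∫ ω, Φ (t + T) ω ^ 2 ∂P ≤ ∫ ω, (Φ t ω ^ 2 + C - ε * Φ t ω +
        ∑ k : Fin N × Fin N, ∑ τ ∈ Finset.Ico t (t + T),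
        w (X t ω) k * ((A τ ω k.1 k.2 : ℝ) - trafficRate P A k.1 k.2)) ∂P := by
      refine integral_mono_ae (hΦ2int _) (hi1.add hi) ?_
      filter_upwards [hb, hzero] with ω h1 h2
      have := hdrift (fun u => A u ω) h1 h2 t
      simp only [Finset.mul_sum] at this
      exact this
    rw [integral_add hi1 hi, hi0, integral_sub hiC ((hΦint t).const_mul ε),
      integral_add (hΦ2int t) (integrable_const C),
      integral_const_mul] at hle
    simpa using hle
  have hsum := sum_le_of_window_drift (y := fun t => ∫ ω, Φ t ω ^ 2 ∂P)
    (z := fun t => ∫ ω, Φ t ω ∂P) (fun t => integral_nonneg fun ω => sq_nonneg _) hwindow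
  set Y0 := ∑ t ∈ Finset.range T, ∫ ω, Φ t ω ^ 2 ∂P with hY0
  have hY00 : 0 ≤ Y0 := Finset.sum_nonneg fun t _ => integral_nonneg fun ω => sq_nonneg _
  set n : ℝ := ((Fintype.card (Fin N × Fin N) : ℕ) : ℝ) with hn
  have hn0 : 0 ≤ n := Nat.cast_nonneg _
  have hlength : ∀ t, ∫⁻ ω, (totalLength (X t ω) : ENNReal) ∂P ≤
      ENNReal.ofReal (n * ∫ ω, Φ t ω ∂P) := fun t => by
    rw [← integral_const_mul, ofReal_integral_eq_lintegral_ofReal ((hΦint t).const_mul n)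
      (ae_of_all _ fun ω => mul_nonneg hn0 (hΦ0 t ω))]
    refine lintegral_mono fun ω => ?_
    rw [← ENNReal.ofReal_natCast]
    exact ENNReal.ofReal_le_ofReal (totalLength_le_lpSize (by linarith) _)
  refine lt_of_le_of_lt (limsup_le_of_le (a := ENNReal.ofReal (n * ((Y0 + C) / ε)))
    (h := ?_)) ENNReal.ofReal_lt_top
  filter_upwards [eventually_ge_atTop 1] with m hm
  have hm0 : (1 : ℝ) ≤ m := by exact_mod_cast hm
  refine ENNReal.div_le_of_le_mul ?_
  calc _ ≤ ∑ t ∈ Finset.range m, ENNReal.ofReal (n * ∫ ω, Φ t ω ∂P) :=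
        Finset.sum_le_sum fun t _ => hlength t
    _ = ENNReal.ofReal (n * ∑ t ∈ Finset.range m, ∫ ω, Φ t ω ∂P) := by
        rw [Finset.mul_sum, ENNReal.ofReal_sum_of_nonneg fun t _ =>
          mul_nonneg hn0 (integral_nonneg (hΦ0 t))]
    _ ≤ ENNReal.ofReal (n * ((Y0 + C) / ε) * m) := by
        refine ENNReal.ofReal_le_ofReal ?_
        rw [mul_assoc]
        refine mul_le_mul_of_nonneg_left ?_ hn0
        rw [div_mul_eq_mul_div, le_div_iff₀' hε]
        -- Since `m ≥ 1`, `Y0 + m C ≤ (Y0 + C) m`.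
        have := hsum m
        nlinarith
    _ = _ := by
        rw [ENNReal.ofReal_mul (by positivity), ENNReal.ofReal_natCast]
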